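/- For $N\in\mathbb N$ and $d>0$ let $y=(y_e)_e\in\{0,1\}^{\binom N2}$ be the vector of edge indicators of the Erdős–Rényi graph $G(N,d/N)$ on $[N]$ (only $N\ge d$ matters). A function $f:\{0,1\}^{\binom N2}\to\mathbb R$ has degree $D$ if it is a linear combination of functions of the form $y\mapsto\prod_{e\in I}f_e(y_e)$ with $|I|\le D$ and $f_e:\{0,1\}\to\mathbb R$ arbitrary. Let $\omega$ be a random variable with values in some space $\Omega_N$ and let $\vec U=(U_1,\dots,U_N)$ be i.i.d. uniform on $[-1,1]$, with $y,\omega,\vec U$ independent. For a measurable $\mathcal A^\circ=\mathcal A^\circ_N:\{0,1\}^{\binom N2}\times\Omega_N\to\mathbb R^N$, let $\mathcal A(y,\omega,\vec U)\in\{-1,1\}^N$ be its randomized rounding, whose $i$-th coordinate is $1$ if $\mathcal A^\circ(y,\omega)_i\ge U_i$ and $-1$ otherwise, identified with the vertex set $\{i\in[N]:\mathcal A(y,\omega,\vec U)_i=1\}$. **Corollary 3.10.** For every $\iota>0$ there exists $d_*(\iota)$ such that for all $d\ge d_*(\iota)$ the following holds. Let $C$ be a constant and let $D=D_N=o(N)$.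 Suppose that, for every $N$ and every fixed $\omega$, each of the $N$ coordinates of $\mathcal A^\circ_N(\cdot,\omega)$ has degree $D_N$, and that $\mathbb E[\|\mathcal A^\circ_N(y,\omega)\|^2]\le CN$ for all sufficiently large $N$. Then $$\mathbb P\Big[\mathcal A(y,\omega,\vec U)\text{ is an independent set of the graph } y \text{ of size at least } \frac{(1+\iota)\log d}{d}\,N\Big]\longrightarrow 0\qquad(N\to\infty).$$ -/

import Mathlib

open MeasureTheory ProbabilityTheory Filter Topology Asymptotics

noncomputable section

namespace SparseIndep

/-- The space of degree `D` functions on `Γ^κ`: the real span of all functions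
`y ↦ ∏ i ∈ I, f i (y i)` with `|I| ≤ D` and arbitrary `f i : Γ → ℝ`. -/
def degreeFunctions (κ Γ : Type*) (D : ℕ) : Submodule ℝ ((κ → Γ) → ℝ) :=
  Submodule.span ℝ
    {F | ∃ (I : Finset κ) (f : κ → Γ → ℝ), I.card ≤ D ∧ F = fun y => ∏ i ∈ I, f i (y i)}

/-- The `N choose 2` unordered pairs of distinct vertices in `Fin N`. -/
abbrev VertexPair (N : ℕ) : Type := {e : Sym2 (Fin N) // ¬ e.IsDiag}

open Classical in
/-- The vector of edge indicators of a graph on `Fin N`, a point of `{0,1}^(N choose 2)`. -/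
def edgeVector {N : ℕ} (G : SimpleGraph (Fin N)) : VertexPair N → Bool :=
  fun e => decide ((e : Sym2 (Fin N)) ∈ G.edgeSet)

/-- The law of the sparse random graph `G(N, d/N)`; the parameter is projected to `[0,1]`,
which has an effect only if `d/N` is not a probability. -/
def sparseGraph (N : ℕ) (d : ℝ) : Measure (SimpleGraph (Fin N)) :=
  SimpleGraph.binomialRandom (Fin N) (Set.projIcc (0 : ℝ) 1 zero_le_one (d / N))

/-- The law of `N` independent uniform random variables on `[-1,1]`. -/
def uniformNoise (N : ℕ) : Measure (Fin N → ℝ) :=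
  Measure.pi fun _ => ProbabilityTheory.cond volume (Set.Icc (-1 : ℝ) 1)

/-- Rounding of a real number at the threshold `u`. -/
def round (u x : ℝ) : ℝ := if u ≤ x then 1 else -1

/-- Coordinatewise rounding of a vector. -/
def roundVector {N : ℕ} (U : Fin N → ℝ) (x : EuclideanSpace ℝ (Fin N)) :
    EuclideanSpace ℝ (Fin N) :=
  WithLp.toLp 2 fun i => round (U i) (x i)

/-- The set of vertices encoded by a `±1`-vector. -/
def vertexSet {N : ℕ} (σ : EuclideanSpace ℝ (Fin N)) : Set (Fin N) := {i | σ i = 1}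

end SparseIndep

end

/-! Resample every edge independently with probability ε of order 1/(D+1) per step. This is a
reversible Markov chain with stationary law G(N, d/N). By Fourier analysis a degree D function moves
little in one step. Hence a stable rounded output that succeeds with probability π succeeds on two
consecutive graphs, with close vertex sets, with probability at least π²/2. By reversibility and
Cauchy–Schwarz this persists along a whole path of length n = 2^m with probability at least (π²/2)^n
(`pow_le_pathProb_stableSuccess`). A length n of order D + 1 = o(N) suffices, so this is e^{-o(N)}.

A first moment bound gives e^{-cN} for the same event (`pathProb_stableSuccess_le`), a
contradiction. Write ℓ = log d and Φ = Nℓ/d, so the sets have size at least (1+ι)Φ. Since they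
change slowly, one of three structures occurs (`exists_incrementChain_or_return`), with β = ιΦ/4:
(a) the first set has size at least 3Φ; (b) there are K+1 sets, each adding between β and 2β
vertices to the union of its predecessors; (c) at least W steps after a shorter chain of this kind,
a set has fewer than β vertices outside the union of the chain. In (b) the first set contributes at
most e^{Φℓ/2+O(Φ)}. Each further set gains the entropy e^{bℓ} of its b new vertices and pays about
e^{-(1+3ι/4)bℓ} for the new pairs, so K of order ι^{-2} links win. In (c) the returning set has
entropy only O(Φ), while its nearly fresh graph costs e^{-(1/2+ι/4)Φℓ}. This beats the e^{Φℓ/2} of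
the chain precisely because the sets exceed Φ by a constant factor.

All this concerns a deterministic map from graphs to sets. For the randomized algorithm, each value
of ω and U gives such a map, which is either rarely successful or unstable; the mean instability is
small by the degree and norm hypotheses, and Markov's inequality concludes. -/

noncomputable section

namespace SparseIndep

/-! ### Path sums of a finite chain -/

section Chain

variable {V : Type*} [Fintype V]

/-- Backward recursion computing sums over paths of length `n` started at a point. -/
def backward (R : V → V → ℝ) : ℕ → (ℕ → V → ℝ) → V → ℝ
  | 0, f, a => f 0 a
  | n + 1, f, a => f 0 a * ∑ b, R a b * backward R n (fun i => f (i + 1)) b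

theorem sum_fin_cons {α : Type*} [Fintype α] {n : ℕ} (F : (Fin (n + 1) → α) → ℝ) :
    ∑ x, F x = ∑ a, ∑ y : Fin n → α, F (Fin.cons a y) := by
  rw [← Fintype.sum_prod_type' (f := fun a (y : Fin n → α) => F (Fin.cons a y))]
  exact (Fintype.sum_equiv (Fin.consEquiv fun _ : Fin (n + 1) => α) _ _ fun _ => rfl).symm

theorem sum_paths_eq_backward (R : V → V → ℝ) (n : ℕ) :
    ∀ (φ : V → ℝ) (f : ℕ → V → ℝ),
      ∑ x : Fin (n + 1) → V, φ (x 0) * (∏ i : Fin n, R (x i.castSucc) (x i.succ)) *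
        ∏ i : Fin (n + 1), f i (x i) = ∑ a, φ a * backward R n f a := by
  induction n with
  | zero =>
    intro φ f
    rw [sum_fin_cons]
    simp [backward]
  | succ n ih =>
    intro φ f
    rw [sum_fin_cons]
    refine Finset.sum_congr rfl fun a _ => ?_
    have := ih (fun b => R a b) (fun i => f (i + 1))
    rw [backward, ← this, Finset.mul_sum, Finset.mul_sum]
    refine Finset.sum_congr rfl fun y _ => ?_
    rw [Fin.prod_univ_succ, Fin.prod_univ_succ (n := n + 1)]
    simp only [Fin.castSucc_zero, Fin.cons_zero, Fin.cons_succ, Fin.val_zero, Fin.val_succ,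
      Fin.castSucc_succ]
    ring

theorem backward_nonneg {R : V → V → ℝ} (hR : ∀ a b, 0 ≤ R a b) (n : ℕ) :
    ∀ (f : ℕ → V → ℝ), (∀ i a, 0 ≤ f i a) → ∀ a, 0 ≤ backward R n f a := by
  induction n with
  | zero => intro f hf a; exact hf 0 a
  | succ n ih =>
    intro f hf a
    exact mul_nonneg (hf 0 a) (Finset.sum_nonneg fun b _ => mul_nonneg (hR a b)
      (ih _ (fun i a => hf _ a) b))

theorem backward_le_one {R : V → V → ℝ} (hR : ∀ a b, 0 ≤ R a b) (hsum : ∀ a, ∑ b, R a b = 1)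
    (n : ℕ) : ∀ (f : ℕ → V → ℝ), (∀ i a, 0 ≤ f i a) → (∀ i a, f i a ≤ 1) →
      ∀ a, backward R n f a ≤ 1 := by
  induction n with
  | zero => intro f _ hf a; exact hf 0 a
  | succ n ih =>
    intro f hf0 hf a
    refine mul_le_one₀ (hf 0 a) (Finset.sum_nonneg fun b _ => mul_nonneg (hR a b)
      (backward_nonneg hR n _ (fun i a => hf0 _ a) b)) ?_
    rw [← hsum a]
    exact Finset.sum_le_sum fun b _ => mul_le_of_le_one_right (hR a b)
      (ih _ (fun i a => hf0 _ a) (fun i a => hf _ a) b)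

/-- Total mass of paths of length `n`. -/
def pathMass (μ : V → ℝ) (R : V → V → ℝ) (n : ℕ) : ℝ :=
  ∑ a, μ a * backward R n (fun _ _ => 1) a

/-- Detailed balance makes `R` self-adjoint for `μ`, so two paths leaving a common point join into
one path of length `m + n`. -/
theorem sum_mul_backward_mul_backward {μ : V → ℝ} {R : V → V → ℝ}
    (hsymm : ∀ a b, μ a * R a b = μ b * R b a) (m : ℕ) : ∀ n,
    ∑ a, μ a * (backward R m (fun _ _ => 1) a * backward R n (fun _ _ => 1) a)
      = pathMass μ R (m + n) := by
  induction m with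
  | zero => intro n; simp [backward, pathMass]
  | succ m ih =>
    intro n
    rw [show m + 1 + n = m + (n + 1) by ring, ← ih (n + 1)]
    simp only [backward, one_mul, Finset.mul_sum, Finset.sum_mul]
    rw [Finset.sum_comm]
    refine Finset.sum_congr rfl fun a _ => Finset.sum_congr rfl fun b _ => ?_
    linear_combination (backward R m (fun _ _ => 1) a * backward R n (fun _ _ => 1) b) * hsymm b a

/-- Cauchy–Schwarz at the midpoint of a path, applied once per doubling of the length. No
normalisation of `R` is required, so the transitions may be restricted to a symmetric set of good
steps. -/
theorem pathMass_one_pow_le {μ : V → ℝ} {R : V → V → ℝ} (hμ : ∀ a, 0 ≤ μ a)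
    (hμ1 : ∑ a, μ a = 1) (hR : ∀ a b, 0 ≤ R a b)
    (hsymm : ∀ a b, μ a * R a b = μ b * R b a) (m : ℕ) :
    pathMass μ R 1 ^ 2 ^ m ≤ pathMass μ R (2 ^ m) := by
  have hnn : ∀ n, 0 ≤ pathMass μ R n := fun n => Finset.sum_nonneg fun a _ =>
    mul_nonneg (hμ a) (backward_nonneg hR n _ (fun _ _ => zero_le_one) a)
  induction m with
  | zero => simp
  | succ m ih =>
    calc pathMass μ R 1 ^ 2 ^ (m + 1) = (pathMass μ R 1 ^ 2 ^ m) ^ 2 := by rw [← pow_mul, pow_succ]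
      _ ≤ pathMass μ R (2 ^ m) ^ 2 := pow_le_pow_left₀ (pow_nonneg (hnn 1) _) ih 2
      _ ≤ ∑ a, μ a * backward R (2 ^ m) (fun _ _ => 1) a ^ 2 :=
        Real.pow_arith_mean_le_arith_mean_pow _ _ _ (fun a _ => hμ a) hμ1
          (fun a _ => backward_nonneg hR _ _ (fun _ _ => zero_le_one) a) 2
      _ = pathMass μ R (2 ^ (m + 1)) := by
        simp only [sq, sum_mul_backward_mul_backward hsymm]
        congr 1; ring

open Classical in
/-- Probability of a set of paths of length `n` of the chain with initial weights `μ` and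
transition weights `R`. -/
def pathProb (μ : V → ℝ) (R : V → V → ℝ) (n : ℕ) (Q : (Fin (n + 1) → V) → Prop) : ℝ :=
  ∑ x : Fin (n + 1) → V, μ (x 0) * (∏ i : Fin n, R (x i.castSucc) (x i.succ)) *
    if Q x then 1 else 0

section

variable {μ : V → ℝ} {R : V → V → ℝ} {n : ℕ}

omit [Fintype V] in
theorem path_weight_nonneg (hμ : ∀ a, 0 ≤ μ a) (hR : ∀ a b, 0 ≤ R a b) (x : Fin (n + 1) → V) :
    0 ≤ μ (x 0) * (∏ i : Fin n, R (x i.castSucc) (x i.succ)) :=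
  mul_nonneg (hμ _) (Finset.prod_nonneg fun _ _ => hR _ _)

theorem pathProb_mono (hμ : ∀ a, 0 ≤ μ a) (hR : ∀ a b, 0 ≤ R a b)
    {Q Q' : (Fin (n + 1) → V) → Prop} (h : ∀ x, Q x → Q' x) :
    pathProb μ R n Q ≤ pathProb μ R n Q' := by
  refine Finset.sum_le_sum fun x _ => mul_le_mul_of_nonneg_left ?_ (path_weight_nonneg hμ hR x)
  by_cases hx : Q x
  · simp [hx, h x hx]
  · simp only [hx, if_false]; split_ifs <;> norm_num

theorem pathProb_or_le (hμ : ∀ a, 0 ≤ μ a) (hR : ∀ a b, 0 ≤ R a b)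
    (Q Q' : (Fin (n + 1) → V) → Prop) :
    pathProb μ R n (fun x => Q x ∨ Q' x) ≤ pathProb μ R n Q + pathProb μ R n Q' := by
  unfold pathProb
  rw [← Finset.sum_add_distrib]
  refine Finset.sum_le_sum fun x _ => ?_
  rw [← mul_add]
  refine mul_le_mul_of_nonneg_left ?_ (path_weight_nonneg hμ hR x)
  by_cases h : Q x <;> by_cases h' : Q' x <;> simp [h, h']

theorem pathProb_exists_le (hμ : ∀ a, 0 ≤ μ a) (hR : ∀ a b, 0 ≤ R a b) {ι : Type*} [Fintype ι]
    (Q : ι → (Fin (n + 1) → V) → Prop) :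
    pathProb μ R n (fun x => ∃ i, Q i x) ≤ ∑ i, pathProb μ R n (Q i) := by
  unfold pathProb
  rw [Finset.sum_comm]
  refine Finset.sum_le_sum fun x _ => ?_
  rw [← Finset.mul_sum]
  refine mul_le_mul_of_nonneg_left ?_ (path_weight_nonneg hμ hR x)
  split_ifs with h
  · obtain ⟨i, hi⟩ := h
    refine le_trans ?_ (Finset.single_le_sum (fun j _ => ?_) (Finset.mem_univ i))
    · simp [hi]
    · split_ifs <;> norm_num
  · exact Finset.sum_nonneg fun j _ => by split_ifs <;> norm_num

theorem pathProb_const_and (c : Prop) [Decidable c] (Q : (Fin (n + 1) → V) → Prop) :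
    pathProb μ R n (fun x => c ∧ Q x) = if c then pathProb μ R n Q else 0 := by
  split_ifs with h
  · simp only [h, true_and]
  · simp [pathProb, h]

theorem pathProb_le_backward (hμ : ∀ a, 0 ≤ μ a) (hR : ∀ a b, 0 ≤ R a b)
    {Q : (Fin (n + 1) → V) → Prop} {f : ℕ → V → ℝ} (hf : ∀ i a, 0 ≤ f i a)
    (h : ∀ x, Q x → ∀ i : Fin (n + 1), f i (x i) = 1) :
    pathProb μ R n Q ≤ ∑ a, μ a * backward R n f a := by
  rw [← sum_paths_eq_backward]
  refine Finset.sum_le_sum fun x _ => mul_le_mul_of_nonneg_left ?_ (path_weight_nonneg hμ hR x)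
  split_ifs with hx
  · rw [Finset.prod_eq_one fun i _ => h x hx i]
  · exact Finset.prod_nonneg fun i _ => hf _ _

open Classical in
theorem pathMass_ite_eq_pathProb (st : V → V → Prop) :
    pathMass μ (fun a b => if st a b then R a b else 0) n
      = pathProb μ R n (fun x => ∀ i : Fin n, st (x i.castSucc) (x i.succ)) := by
  rw [pathMass, ← sum_paths_eq_backward, pathProb]
  refine Finset.sum_congr rfl fun x _ => ?_
  rw [Finset.prod_const_one, mul_one, mul_assoc]
  congr 1
  split_ifs with h
  · rw [mul_one]; exact Finset.prod_congr rfl fun i _ => by rw [if_pos (h i)]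
  · push Not at h
    obtain ⟨i, hi⟩ := h
    rw [mul_zero]; exact Finset.prod_eq_zero (Finset.mem_univ i) (if_neg hi)

end

end Chain

/-! ### Independent resampling of Bernoulli coordinates -/

/-- Bernoulli weights. -/
def bern (p : ℝ) (b : Bool) : ℝ := if b then p else 1 - p

/-- Transition weights of one coordinate that is resampled with probability `ε`. -/
def site (p ε : ℝ) (a b : Bool) : ℝ := (1 - ε) * (if a = b then 1 else 0) + ε * bern p b

theorem bern_nonneg {p : ℝ} (h0 : 0 ≤ p) (h1 : p ≤ 1) (b : Bool) : 0 ≤ bern p b := by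
  cases b <;> simp [bern, h0, h1]

theorem sum_bern (p : ℝ) : ∑ b, bern p b = 1 := by simp [bern]

theorem site_nonneg {p ε : ℝ} (h0 : 0 ≤ p) (h1 : p ≤ 1) (e0 : 0 ≤ ε) (e1 : ε ≤ 1) (a b : Bool) :
    0 ≤ site p ε a b :=
  add_nonneg (mul_nonneg (by linarith) (by split_ifs <;> norm_num))
    (mul_nonneg e0 (bern_nonneg h0 h1 b))

theorem sum_site (p ε : ℝ) (a : Bool) : ∑ b, site p ε a b = 1 := by
  cases a <;> simp [site, bern] <;> ring

theorem bern_mul_site (p ε : ℝ) (a b : Bool) :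
    bern p a * site p ε a b = bern p b * site p ε b a := by
  cases a <;> cases b <;> simp [site, bern] <;> ring

section Product

variable {κ : Type*} [Fintype κ] [DecidableEq κ]

/-- Product Bernoulli weights. -/
def prodBern (p : ℝ) (y : κ → Bool) : ℝ := ∏ e, bern p (y e)

/-- Transition weights when all coordinates are resampled independently. -/
def resample (p ε : ℝ) (y y' : κ → Bool) : ℝ := ∏ e, site p ε (y e) (y' e)

theorem sum_prod_apply (g : κ → Bool → ℝ) : ∑ y : κ → Bool, ∏ e, g e (y e) = ∏ e, ∑ b, g e b := by
  rw [Finset.prod_univ_sum, Fintype.piFinset_univ]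

omit [DecidableEq κ] in
theorem prodBern_nonneg {p : ℝ} (h0 : 0 ≤ p) (h1 : p ≤ 1) (y : κ → Bool) : 0 ≤ prodBern p y :=
  Finset.prod_nonneg fun _ _ => bern_nonneg h0 h1 _

theorem sum_prodBern (p : ℝ) : ∑ y : κ → Bool, prodBern p y = 1 := by
  simp only [prodBern]
  rw [sum_prod_apply (fun _ => bern p)]; simp only [sum_bern, Finset.prod_const_one]

omit [DecidableEq κ] in
theorem resample_nonneg {p ε : ℝ} (h0 : 0 ≤ p) (h1 : p ≤ 1) (e0 : 0 ≤ ε) (e1 : ε ≤ 1)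
    (y y' : κ → Bool) : 0 ≤ resample p ε y y' :=
  Finset.prod_nonneg fun _ _ => site_nonneg h0 h1 e0 e1 _ _

theorem sum_resample (p ε : ℝ) (y : κ → Bool) : ∑ y', resample p ε y y' = 1 := by
  simp only [resample]
  rw [sum_prod_apply (fun e => site p ε (y e))]; simp only [sum_site, Finset.prod_const_one]

omit [DecidableEq κ] in
theorem prodBern_mul_resample (p ε : ℝ) (y y' : κ → Bool) :
    prodBern p y * resample p ε y y' = prodBern p y' * resample p ε y' y := by
  simp only [prodBern, resample, ← Finset.prod_mul_distrib]
  exact Finset.prod_congr rfl fun e _ => bern_mul_site p ε _ _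

/-- Coordinates evolve independently, so product functionals of the path factor and every path
estimate reduces to a single coordinate. -/
theorem backward_resample (p ε : ℝ) (n : ℕ) : ∀ (g : κ → ℕ → Bool → ℝ) (y : κ → Bool),
    backward (resample p ε) n (fun i y => ∏ e, g e i (y e)) y
      = ∏ e, backward (site p ε) n (g e) (y e) := by
  induction n with
  | zero => intro g y; rfl
  | succ n ih =>
    intro g y
    simp only [backward]
    rw [Finset.prod_mul_distrib]
    congr 1
    rw [← sum_prod_apply (fun e b => site p ε (y e) b * backward (site p ε) n (fun i => g e (i + 1)) b)]
    refine Finset.sum_congr rfl fun y' _ => ?_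
    rw [ih (fun e i => g e (i + 1)) y', resample, ← Finset.prod_mul_distrib]

theorem sum_prodBern_mul_backward (p ε : ℝ) (n : ℕ) (g : κ → ℕ → Bool → ℝ) :
    ∑ y, prodBern p y * backward (resample p ε) n (fun i y => ∏ e, g e i (y e)) y
      = ∏ e, ∑ b, bern p b * backward (site p ε) n (g e) b := by
  rw [← sum_prod_apply]
  refine Finset.sum_congr rfl fun y _ => ?_
  rw [backward_resample, prodBern, ← Finset.prod_mul_distrib]

end Product

/-! ### One coordinate -/

/-- Probability that a coordinate with value `a` vanishes after `m` resampling steps. -/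
def vanish (p ε : ℝ) (m : ℕ) (a : Bool) : ℝ :=
  (1 - p) + (1 - ε) ^ m * ((if a then 0 else 1) - (1 - p))

theorem sum_site_mul_vanish (p ε : ℝ) (m : ℕ) (a : Bool) :
    ∑ b, site p ε a b * vanish p ε m b = vanish p ε (m + 1) a := by
  cases a <;> simp [site, bern, vanish] <;> ring

theorem sum_bern_mul_vanish (p ε : ℝ) (m : ℕ) : ∑ b, bern p b * vanish p ε m b = 1 - p := by
  simp [bern, vanish]; ring

section Site

variable {p ε : ℝ} (h0 : 0 ≤ p) (h1 : p ≤ 1) (e0 : 0 ≤ ε) (e1 : ε ≤ 1)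
include h0 h1 e0 e1

/-- Only the constraint at time `t` is kept; all other weights are bounded by 1. -/
theorem backward_le_vanish (t : ℕ) : ∀ (n : ℕ) (f : ℕ → Bool → ℝ), t ≤ n → (∀ i a, 0 ≤ f i a) →
    (∀ i a, f i a ≤ 1) → f t true = 0 → ∀ a, backward (site p ε) n f a ≤ vanish p ε t a := by
  induction t with
  | zero =>
    intro n f _ hf0 hf1 hft a
    cases a with
    | false =>
      refine (backward_le_one (site_nonneg h0 h1 e0 e1) (sum_site p ε) n f hf0 hf1 _).trans ?_
      simp [vanish]
    | true => cases n <;> simp [backward, vanish, hft]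
  | succ t ih =>
    intro n f htn hf0 hf1 hft a
    obtain ⟨n, rfl⟩ : ∃ n', n = n' + 1 := ⟨n - 1, by omega⟩
    rw [← sum_site_mul_vanish, backward]
    have hs : ∀ b, 0 ≤ site p ε a b * backward (site p ε) n (fun i => f (i + 1)) b := fun b =>
      mul_nonneg (site_nonneg h0 h1 e0 e1 _ _)
        (backward_nonneg (site_nonneg h0 h1 e0 e1) n _ (fun i a => hf0 _ a) b)
    refine (mul_le_of_le_one_left (Finset.sum_nonneg fun b _ => hs b) (hf1 0 a)).trans ?_
    exact Finset.sum_le_sum fun b _ => mul_le_mul_of_nonneg_left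
      (ih n (fun i => f (i + 1)) (by omega) (fun i a => hf0 _ a) (fun i a => hf1 _ a) hft b)
      (site_nonneg h0 h1 e0 e1 _ _)

/-- Markov property at time `s`: the coordinate is then `false`, and the chain restarts from there
for `m` steps. -/
theorem backward_le_vanish_mul (m s : ℕ) : ∀ (n : ℕ) (f : ℕ → Bool → ℝ), s + m ≤ n →
    (∀ i a, 0 ≤ f i a) → (∀ i a, f i a ≤ 1) → f s true = 0 → f (s + m) true = 0 →
    ∀ a, backward (site p ε) n f a ≤ vanish p ε m false * vanish p ε s a := by
  induction s with
  | zero =>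
    intro n f hn hf0 hf1 hfs hft a
    cases a with
    | false =>
      refine (backward_le_vanish h0 h1 e0 e1 m n f (by omega) hf0 hf1 (by simpa using hft) _).trans ?_
      simp [vanish]
    | true => cases n <;> simp [backward, vanish, hfs]
  | succ s ih =>
    intro n f htn hf0 hf1 hfs hft a
    obtain ⟨n, rfl⟩ : ∃ n', n = n' + 1 := ⟨n - 1, by omega⟩
    rw [← sum_site_mul_vanish, backward, Finset.mul_sum (f := fun b => site p ε a b * vanish p ε s b)]
    have hs : ∀ b, 0 ≤ site p ε a b * backward (site p ε) n (fun i => f (i + 1)) b := fun b =>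
      mul_nonneg (site_nonneg h0 h1 e0 e1 _ _)
        (backward_nonneg (site_nonneg h0 h1 e0 e1) n _ (fun i a => hf0 _ a) b)
    refine (mul_le_of_le_one_left (Finset.sum_nonneg fun b _ => hs b) (hf1 0 a)).trans ?_
    refine Finset.sum_le_sum fun b _ => ?_
    rw [mul_left_comm]
    refine mul_le_mul_of_nonneg_left
      (ih n (fun i => f (i + 1)) (by omega) (fun i a => hf0 _ a) (fun i a => hf1 _ a) hfs ?_ b)
      (site_nonneg h0 h1 e0 e1 _ _)
    rw [← hft]; congr 1; omega

theorem sum_bern_backward_le {n t : ℕ} {f : ℕ → Bool → ℝ} (ht : t ≤ n) (hf0 : ∀ i a, 0 ≤ f i a)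
    (hf1 : ∀ i a, f i a ≤ 1) (hft : f t true = 0) :
    ∑ b, bern p b * backward (site p ε) n f b ≤ Real.exp (-p) := by
  refine (Finset.sum_le_sum fun b _ => mul_le_mul_of_nonneg_left
    (backward_le_vanish h0 h1 e0 e1 t n f ht hf0 hf1 hft b) (bern_nonneg h0 h1 b)).trans ?_
  rw [sum_bern_mul_vanish]
  linarith [Real.add_one_le_exp (-p)]

/-- The first zero costs 1 - p. Given it, the second has probability (1 - p) + (1-ε)^m p ≤ 1 -
(1-η)p, since at least `W` steps separate the two. -/
theorem sum_bern_backward_le_of_far {n s t W : ℕ} {η : ℝ} {f : ℕ → Bool → ℝ} (ht : t ≤ n)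
    (hst : s + W ≤ t) (hW : (1 - ε) ^ W ≤ η) (hf0 : ∀ i a, 0 ≤ f i a)
    (hf1 : ∀ i a, f i a ≤ 1) (hfs : f s true = 0) (hft : f t true = 0) :
    ∑ b, bern p b * backward (site p ε) n f b ≤ Real.exp (-p - (1 - η) * p) := by
  obtain ⟨m, rfl⟩ : ∃ m, t = s + m := ⟨t - s, by omega⟩
  refine (Finset.sum_le_sum fun b _ => mul_le_mul_of_nonneg_left
    (backward_le_vanish_mul h0 h1 e0 e1 m s n f ht hf0 hf1 hfs hft b) (bern_nonneg h0 h1 b)).trans ?_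
  have : ∑ b, bern p b * (vanish p ε m false * vanish p ε s b)
      = vanish p ε m false * (1 - p) := by
    rw [← sum_bern_mul_vanish p ε s, Finset.mul_sum]
    exact Finset.sum_congr rfl fun b _ => by ring
  rw [this, sub_eq_add_neg (-p), Real.exp_add, mul_comm]
  have hm : (1 - ε) ^ m ≤ η :=
    (pow_le_pow_of_le_one (by linarith) (by linarith) (by omega)).trans hW
  have hm0 : 0 ≤ (1 - ε) ^ m := pow_nonneg (by linarith) _
  refine mul_le_mul (by linarith [Real.add_one_le_exp (-p)]) ?_ ?_ (Real.exp_nonneg _)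
  · have := Real.add_one_le_exp (-((1 - η) * p))
    simp only [vanish, Bool.false_eq_true, if_false]
    nlinarith
  · simp only [vanish, Bool.false_eq_true, if_false]
    nlinarith

end Site

section Constraint

variable {κ : Type*} [Fintype κ] [DecidableEq κ]

/-- The probability that prescribed coordinates vanish at prescribed times. -/
theorem pathProb_vanish_le {p ε : ℝ} (h0 : 0 ≤ p) (h1 : p ≤ 1) (e0 : 0 ≤ ε) (e1 : ε ≤ 1)
    {n W : ℕ} {η : ℝ} (hη : 0 ≤ η) (hW : (1 - ε) ^ W ≤ η) {J : Type*} [Fintype J]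
    (τ : J → Fin (n + 1)) (F : J → Finset κ) (t' : Fin (n + 1)) (F' : Finset κ)
    (hfar : F'.Nonempty → ∀ j, (τ j : ℕ) + W ≤ t') :
    pathProb (prodBern p) (resample p ε) n (fun x : Fin (n + 1) → κ → Bool =>
        (∀ j, ∀ e ∈ F j, x (τ j) e = false) ∧ ∀ e ∈ F', x t' e = false)
      ≤ Real.exp (-(p * (Finset.univ.biUnion F).card) - (1 - η) * p * F'.card) := by
  classical
  -- The weight kills the value `true` at each prescribed time. A coordinate lying in several `F j`
  -- is charged only once, which is why the union appears in the bound; lying in `F'` too gives a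
  -- second, slightly discounted, charge.
  set g : κ → ℕ → Bool → ℝ := fun e i b =>
    if (∃ j, (τ j : ℕ) = i ∧ e ∈ F j) ∨ (i = t' ∧ e ∈ F') then (if b then 0 else 1) else 1 with hg
  have hg0 : ∀ e i b, 0 ≤ g e i b := fun e i b => by
    simp only [hg]; split_ifs <;> norm_num
  have hg1 : ∀ e i b, g e i b ≤ 1 := fun e i b => by
    simp only [hg]; split_ifs <;> norm_num
  refine (pathProb_le_backward (prodBern_nonneg h0 h1) (resample_nonneg h0 h1 e0 e1)
    (f := fun i y => ∏ e, g e i (y e)) (fun i y => Finset.prod_nonneg fun e _ => hg0 _ _ _)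
    ?_).trans ?_
  · rintro x ⟨hx, hx'⟩ i
    refine Finset.prod_eq_one fun e _ => ?_
    simp only [hg]
    split_ifs with h hb
    · rcases h with ⟨j, hj, he⟩ | ⟨hi, he⟩
      · rw [← Fin.ext hj, hx j e he] at hb; cases hb
      · rw [Fin.ext hi, hx' e he] at hb; cases hb
    · rfl
    · rfl
  rw [sum_prodBern_mul_backward]
  have hexp : Real.exp (-(p * (Finset.univ.biUnion F).card) - (1 - η) * p * F'.card)
      = ∏ e : κ, Real.exp (-(if e ∈ Finset.univ.biUnion F then p else 0)
          - (if e ∈ F' then (1 - η) * p else 0)) := by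
    rw [← Real.exp_sum, Finset.sum_sub_distrib, Finset.sum_neg_distrib, Finset.sum_ite_mem,
      Finset.sum_ite_mem, Finset.sum_const, Finset.sum_const]
    simp [mul_comm]
  rw [hexp]
  refine Finset.prod_le_prod (fun e _ => Finset.sum_nonneg fun b _ => mul_nonneg
    (bern_nonneg h0 h1 b) (backward_nonneg (site_nonneg h0 h1 e0 e1) _ _ (hg0 e) b)) fun e _ => ?_
  by_cases hF : e ∈ Finset.univ.biUnion F
  · obtain ⟨j, -, hj⟩ := Finset.mem_biUnion.1 hF
    have hgj : g e (τ j) true = 0 := by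
      simp only [hg]; rw [if_pos (Or.inl ⟨j, rfl, hj⟩)]; rfl
    by_cases hF' : e ∈ F'
    · rw [if_pos hF, if_pos hF']
      exact sum_bern_backward_le_of_far h0 h1 e0 e1 (Nat.le_of_lt_succ t'.2)
        (hfar ⟨e, hF'⟩ j) hW (hg0 e) (hg1 e) hgj
        (by simp only [hg]; rw [if_pos (Or.inr ⟨trivial, hF'⟩)]; rfl)
    · rw [if_pos hF, if_neg hF', sub_zero]
      exact sum_bern_backward_le h0 h1 e0 e1 (Nat.le_of_lt_succ (τ j).2) (hg0 e) (hg1 e) hgj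
  · by_cases hF' : e ∈ F'
    · rw [if_neg hF, if_pos hF']
      refine (sum_bern_backward_le h0 h1 e0 e1 (Nat.le_of_lt_succ t'.2) (hg0 e) (hg1 e)
        (by simp only [hg]; rw [if_pos (Or.inr ⟨trivial, hF'⟩)]; rfl)).trans ?_
      rw [Real.exp_le_exp]; nlinarith
    · rw [if_neg hF, if_neg hF', neg_zero, sub_zero, Real.exp_zero, ← sum_bern p]
      exact Finset.sum_le_sum fun b _ => mul_le_of_le_one_right (bern_nonneg h0 h1 b)
        (backward_le_one (site_nonneg h0 h1 e0 e1) (sum_site p ε) _ _ (hg0 e) (hg1 e) b)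

end Constraint

/-! ### Fourier expansion -/

section Fourier

variable {κ : Type*} [Fintype κ] [DecidableEq κ]

/-- Centred coordinate. -/
def centred (p : ℝ) (b : Bool) : ℝ := (if b then 1 else 0) - p

/-- Products of centred coordinates. -/
def chi (p : ℝ) (S : Finset κ) (y : κ → Bool) : ℝ := ∏ e ∈ S, centred p (y e)

omit [Fintype κ] [DecidableEq κ] in
theorem chi_empty (p : ℝ) (y : κ → Bool) : chi p ∅ y = 1 := rfl

theorem chi_eq_prod (p : ℝ) (S : Finset κ) (y : κ → Bool) :
    chi p S y = ∏ e, if e ∈ S then centred p (y e) else 1 := by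
  rw [Finset.prod_ite_mem, Finset.univ_inter, chi]

/-- The characters diagonalise the chain, with eigenvalue (1-ε)^|S|. -/
theorem sum_resample_mul_chi (p ε : ℝ) (S : Finset κ) (y : κ → Bool) :
    ∑ y', resample p ε y y' * chi p S y' = (1 - ε) ^ S.card * chi p S y := by
  simp only [chi_eq_prod, resample, ← Finset.prod_mul_distrib]
  rw [sum_prod_apply (fun e b => site p ε (y e) b * if e ∈ S then centred p b else 1)]
  have : (1 - ε) ^ S.card = ∏ e : κ, if e ∈ S then (1 - ε) else 1 := by
    rw [Finset.prod_ite_mem, Finset.univ_inter, Finset.prod_const]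
  rw [this, ← Finset.prod_mul_distrib]
  refine Finset.prod_congr rfl fun e _ => ?_
  split_ifs
  · cases y e <;> simp [site, bern, centred] <;> ring
  · simp only [mul_one, sum_site]

theorem sum_prodBern_mul_chi_mul_chi (p : ℝ) (S S' : Finset κ) :
    ∑ y, prodBern p y * (chi p S y * chi p S' y)
      = if S = S' then (p * (1 - p)) ^ S.card else 0 := by
  simp only [chi_eq_prod, prodBern, ← Finset.prod_mul_distrib]
  rw [sum_prod_apply (fun e b => bern p b * ((if e ∈ S then centred p b else 1) *
    if e ∈ S' then centred p b else 1))]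
  split_ifs with h
  · subst h
    have : (p * (1 - p)) ^ S.card = ∏ e : κ, if e ∈ S then p * (1 - p) else 1 := by
      rw [Finset.prod_ite_mem, Finset.univ_inter, Finset.prod_const]
    rw [this]
    refine Finset.prod_congr rfl fun e _ => ?_
    split_ifs
    · simp [bern, centred]; ring
    · simp only [mul_one, sum_bern]
  · obtain ⟨e, he⟩ : ∃ e, ¬ (e ∈ S ↔ e ∈ S') := by
      by_contra hc; push Not at hc; exact h (Finset.ext hc)
    refine Finset.prod_eq_zero (Finset.mem_univ e) ?_
    by_cases h1 : e ∈ S <;> by_cases h2 : e ∈ S'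
    · exact absurd ⟨fun _ => h2, fun _ => h1⟩ he
    · simp [h1, h2, bern, centred]; ring
    · simp [h1, h2, bern, centred]; ring
    · exact absurd ⟨fun h => absurd h h1, fun h => absurd h h2⟩ he

theorem exists_chi_expansion (p : ℝ) {D : ℕ} {f : (κ → Bool) → ℝ}
    (hf : f ∈ degreeFunctions κ Bool D) :
    ∃ c : Finset κ → ℝ, (∀ S, D < S.card → c S = 0) ∧ ∀ y, f y = ∑ S, c S * chi p S y := by
  induction hf using Submodule.span_induction with
  | mem f hf =>
    obtain ⟨I, g, hI, rfl⟩ := hf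
    -- Each factor is its slope times the centred coordinate plus its mean; the product over `I` is
    -- then expanded.
    refine ⟨fun S => if S ⊆ I then (∏ i ∈ S, (g i true - g i false)) *
      ∏ i ∈ I \ S, (g i false + (g i true - g i false) * p) else 0, fun S hS => ?_, fun y => ?_⟩
    · exact if_neg fun h => absurd (Finset.card_le_card h) (by omega)
    · have h1 : ∀ i ∈ I, g i (y i) = (g i true - g i false) * centred p (y i)
          + (g i false + (g i true - g i false) * p) := fun i _ => by
        cases y i
        · simp [centred]
        · simp only [centred, if_true]; ring
      simp only
      rw [Finset.prod_congr rfl h1, Finset.prod_add]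
      have h2 : I.powerset = Finset.univ.filter (· ⊆ I) := by ext; simp
      rw [h2, Finset.sum_filter]
      refine Finset.sum_congr rfl fun S _ => ?_
      split_ifs
      · rw [Finset.prod_mul_distrib, chi]; ring
      · rw [zero_mul]
  | zero => exact ⟨0, by simp, by simp⟩
  | add f g _ _ hf hg =>
    obtain ⟨c, hc, hf⟩ := hf
    obtain ⟨c', hc', hg⟩ := hg
    refine ⟨c + c', fun S hS => by simp [hc S hS, hc' S hS], fun y => ?_⟩
    simp [hf, hg, add_mul, Finset.sum_add_distrib]
  | smul a f _ hf =>
    obtain ⟨c, hc, hf⟩ := hf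
    refine ⟨a • c, fun S hS => by simp [hc S hS], fun y => ?_⟩
    simp [hf, Finset.mul_sum, mul_assoc]

theorem mem_degreeFunctions_card (f : (κ → Bool) → ℝ) :
    f ∈ degreeFunctions κ Bool (Fintype.card κ) := by
  have : f = ∑ z : κ → Bool, f z • fun y => ∏ e ∈ Finset.univ, if y e = z e then (1 : ℝ) else 0 := by
    funext y
    rw [Finset.sum_apply, Finset.sum_eq_single y]
    · simp
    · intro z _ hz
      obtain ⟨e, he⟩ := Function.ne_iff.1 hz
      simp only [Pi.smul_apply, smul_eq_mul]
      rw [Finset.prod_eq_zero (Finset.mem_univ e) (if_neg (Ne.symm he)), mul_zero]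
    · simp
  rw [this]
  exact Submodule.sum_mem _ fun z _ => Submodule.smul_mem _ _ (Submodule.subset_span
    ⟨Finset.univ, fun e b => if b = z e then 1 else 0, le_rfl, rfl⟩)

theorem sum_resample_expansion (p ε : ℝ) {f : (κ → Bool) → ℝ} {c : Finset κ → ℝ}
    (hf : ∀ y, f y = ∑ S, c S * chi p S y) :
    ∑ y, ∑ y', prodBern p y * resample p ε y y' * (f y * f y')
      = ∑ S, c S ^ 2 * (p * (1 - p)) ^ S.card * (1 - ε) ^ S.card := by
  have h1 : ∀ y, ∑ y', prodBern p y * resample p ε y y' * (f y * f y')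
      = ∑ S, ∑ S', c S * c S' * (1 - ε) ^ S'.card * (prodBern p y * (chi p S y * chi p S' y)) := by
    intro y
    have h2 : ∑ y', resample p ε y y' * f y' = ∑ S', c S' * ((1 - ε) ^ S'.card * chi p S' y) := by
      simp only [← sum_resample_mul_chi, hf, Finset.mul_sum]
      rw [Finset.sum_comm]
      exact Finset.sum_congr rfl fun _ _ => Finset.sum_congr rfl fun _ _ => by ring
    calc ∑ y', prodBern p y * resample p ε y y' * (f y * f y')
        = prodBern p y * f y * ∑ y', resample p ε y y' * f y' := by
          rw [Finset.mul_sum]; exact Finset.sum_congr rfl fun _ _ => by ring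
      _ = _ := by
          rw [h2, hf, Finset.mul_sum (f := fun S => c S * chi p S y), Finset.sum_mul_sum]
          exact Finset.sum_congr rfl fun _ _ => Finset.sum_congr rfl fun _ _ => by ring
  rw [Finset.sum_congr rfl fun y _ => h1 y, Finset.sum_comm]
  refine Finset.sum_congr rfl fun S _ => ?_
  rw [Finset.sum_comm]
  simp only [← Finset.mul_sum, sum_prodBern_mul_chi_mul_chi]
  rw [Finset.sum_eq_single S]
  · rw [if_pos rfl]; ring
  · intro S' _ h; rw [if_neg (Ne.symm h), mul_zero]
  · simp

theorem sum_prodBern_mul_resample_left (p ε : ℝ) (g : (κ → Bool) → ℝ) :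
    ∑ y, ∑ y', prodBern p y * resample p ε y y' * g y = ∑ y, prodBern p y * g y := by
  refine Finset.sum_congr rfl fun y _ => ?_
  rw [← Finset.sum_mul, ← Finset.mul_sum, sum_resample, mul_one]

theorem sum_prodBern_mul_resample_right (p ε : ℝ) (g : (κ → Bool) → ℝ) :
    ∑ y, ∑ y', prodBern p y * resample p ε y y' * g y' = ∑ y, prodBern p y * g y := by
  rw [Finset.sum_comm, ← sum_prodBern_mul_resample_left p ε g]
  exact Finset.sum_congr rfl fun _ _ => Finset.sum_congr rfl fun _ _ => by
    rw [prodBern_mul_resample]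

omit [DecidableEq κ] in
theorem resample_zero (p : ℝ) (y y' : κ → Bool) :
    resample p 0 y y' = if y = y' then 1 else 0 := by
  simp only [resample, site, sub_zero, one_mul, zero_mul, add_zero]
  split_ifs with h
  · simp [h]
  · obtain ⟨e, he⟩ := Function.ne_iff.1 h
    exact Finset.prod_eq_zero (Finset.mem_univ e) (if_neg he)

theorem sum_sq_expansion (p : ℝ) {f : (κ → Bool) → ℝ} {c : Finset κ → ℝ}
    (hf : ∀ y, f y = ∑ S, c S * chi p S y) :
    ∑ y, prodBern p y * f y ^ 2 = ∑ S, c S ^ 2 * (p * (1 - p)) ^ S.card := by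
  -- At ε = 0 the chain stands still, so the two-point formula becomes Parseval.
  have := sum_resample_expansion p 0 hf
  simp only [resample_zero, sub_zero, one_pow, mul_one] at this
  rw [← this]
  simp [sq]

/-- Low degree functions are stable under resampling. -/
theorem sum_resample_sub_sq_le {p ε : ℝ} (h0 : 0 ≤ p) (h1 : p ≤ 1) (e0 : 0 ≤ ε) (e1 : ε ≤ 1)
    {D : ℕ} {f : (κ → Bool) → ℝ} (hf : f ∈ degreeFunctions κ Bool D) :
    ∑ y, ∑ y', prodBern p y * resample p ε y y' * (f y - f y') ^ 2
      ≤ 2 * D * ε * ∑ y, prodBern p y * f y ^ 2 := by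
  obtain ⟨c, hc, hfc⟩ := exists_chi_expansion p hf
  have h : ∑ y, ∑ y', prodBern p y * resample p ε y y' * (f y - f y') ^ 2
      = 2 * (∑ y, prodBern p y * f y ^ 2)
        - 2 * ∑ y, ∑ y', prodBern p y * resample p ε y y' * (f y * f y') := by
    rw [two_mul]
    nth_rw 1 [← sum_prodBern_mul_resample_left p ε (fun y => f y ^ 2)]
    rw [← sum_prodBern_mul_resample_right p ε (fun y => f y ^ 2)]
    simp only [Finset.mul_sum, ← Finset.sum_add_distrib, ← Finset.sum_sub_distrib]
    exact Finset.sum_congr rfl fun _ _ => Finset.sum_congr rfl fun _ _ => by ring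
  rw [h, sum_resample_expansion p ε hfc, sum_sq_expansion p hfc, Finset.mul_sum, Finset.mul_sum,
    Finset.mul_sum, ← Finset.sum_sub_distrib]
  refine Finset.sum_le_sum fun S _ => ?_
  by_cases hS : D < S.card
  · simp [hc S hS]
  · have hb := one_add_mul_le_pow (a := -ε) (by linarith) S.card
    have hD : (S.card : ℝ) ≤ D := by exact_mod_cast not_lt.1 hS
    have hv : 0 ≤ c S ^ 2 * (p * (1 - p)) ^ S.card :=
      mul_nonneg (sq_nonneg _) (pow_nonneg (mul_nonneg h0 (by linarith)) _)
    -- Bernoulli's inequality: a character of size at most `D` loses at most a fraction Dε of its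
    -- correlation.
    have : 1 - (1 - ε) ^ S.card ≤ D * ε := by
      have h3 : 1 - ε = 1 + -ε := by ring
      rw [h3]; nlinarith
    nlinarith [mul_le_mul_of_nonneg_left this hv]

/-- Every Fourier term of the two-point function is nonnegative, and the empty character alone gives
the squared mean. For an indicator: successes at consecutive times are positively correlated. -/
theorem sq_sum_le_sum_resample {p ε : ℝ} (h0 : 0 ≤ p) (h1 : p ≤ 1) (e1 : ε ≤ 1)
    (f : (κ → Bool) → ℝ) :
    (∑ y, prodBern p y * f y) ^ 2
      ≤ ∑ y, ∑ y', prodBern p y * resample p ε y y' * (f y * f y') := by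
  obtain ⟨c, -, hfc⟩ := exists_chi_expansion p (mem_degreeFunctions_card f)
  have hmean : ∑ y, prodBern p y * f y = c ∅ := by
    simp only [hfc, Finset.mul_sum]
    rw [Finset.sum_comm, Finset.sum_eq_single ∅]
    · simp only [chi_empty, mul_one]
      rw [← Finset.sum_mul, sum_prodBern, one_mul]
    · intro S _ hS
      have := sum_prodBern_mul_chi_mul_chi p S ∅
      rw [if_neg hS] at this
      simp only [chi_empty, mul_one] at this
      calc ∑ y, prodBern p y * (c S * chi p S y) = c S * ∑ y, prodBern p y * chi p S y := by
            rw [Finset.mul_sum]; exact Finset.sum_congr rfl fun _ _ => by ring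
        _ = 0 := by rw [this, mul_zero]
    · simp
  rw [hmean, sum_resample_expansion p ε hfc]
  refine le_trans ?_ (Finset.single_le_sum (fun S _ => ?_) (Finset.mem_univ ∅))
  · simp
  · exact mul_nonneg (mul_nonneg (sq_nonneg _) (pow_nonneg (mul_nonneg h0 (by linarith)) _))
      (pow_nonneg (by linarith) _)

end Fourier

/-! ### Chains of sets with small increments -/

section IncrementChain

variable {α : Type*} [DecidableEq α]

/-- `σ k, …, σ 0` are sets of size at least `a`, the first one of size at most `M`, and each of the
others has between `β` and `2 * β` elements outside of the union of its predecessors. -/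
def IncrementChain (a M β : ℝ) : (k : ℕ) → (Fin (k + 1) → Finset α) → Prop
  | 0, σ => a ≤ (σ 0).card ∧ (σ 0).card ≤ M
  | k + 1, σ => IncrementChain a M β k (Fin.tail σ) ∧ a ≤ (σ 0).card ∧
      β ≤ (σ 0 \ Finset.univ.biUnion (Fin.tail σ)).card ∧
      (σ 0 \ Finset.univ.biUnion (Fin.tail σ)).card ≤ 2 * β

theorem biUnion_fin_succ {β : Type*} [DecidableEq β] {k : ℕ} (σ : Fin (k + 1) → Finset β) :
    Finset.univ.biUnion σ = σ 0 ∪ Finset.univ.biUnion (Fin.tail σ) := by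
  ext x
  simp [Fin.exists_fin_succ, Fin.tail]

theorem IncrementChain.card_biUnion_le {a M β : ℝ} {k : ℕ} {σ : Fin (k + 1) → Finset α}
    (h : IncrementChain a M β k σ) :
    ((Finset.univ.biUnion σ).card : ℝ) ≤ M + 2 * k * β := by
  induction k with
  | zero => simpa [biUnion_fin_succ] using h.2
  | succ k ih =>
    obtain ⟨h, -, -, h2⟩ := h
    rw [biUnion_fin_succ, ← Finset.sdiff_union_self_eq_union]
    have := Finset.card_union_le (σ 0 \ Finset.univ.biUnion (Fin.tail σ))
      (Finset.univ.biUnion (Fin.tail σ))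
    have h3 : (((σ 0 \ Finset.univ.biUnion (Fin.tail σ)) ∪
      Finset.univ.biUnion (Fin.tail σ)).card : ℝ) ≤
      (σ 0 \ Finset.univ.biUnion (Fin.tail σ)).card +
      (Finset.univ.biUnion (Fin.tail σ)).card := by exact_mod_cast this
    have := ih h
    push_cast
    linarith

/-- A sequence of sets with small increments either contains a long chain, or at some time it comes
back to the union of a chain from the past. -/
theorem exists_incrementChain_or_return {a M β : ℝ} (hβ : 0 < β) {A : ℕ → Finset α} {T W : ℕ}
    (hW : 0 < W)
    (ha : ∀ t ≤ T, a ≤ (A t).card) (hM : ((A 0).card : ℝ) ≤ M)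
    (hstep : ∀ t < T, ((A (t + 1) \ A t).card : ℝ) ≤ β) (k : ℕ) (hk : k * W ≤ T) :
    (∃ j < k, ∃ τ : Fin (j + 1) → ℕ, ∃ t' ≤ T, IncrementChain a M β j (fun i => A (τ i)) ∧
      (∀ i, τ i + W ≤ t') ∧ ((A t' \ Finset.univ.biUnion fun i => A (τ i)).card : ℝ) < β) ∨
    ∃ τ : Fin (k + 1) → ℕ, IncrementChain a M β k (fun i => A (τ i)) ∧ ∀ i, τ i ≤ k * W := by
  induction k with
  | zero => exact Or.inr ⟨fun _ => 0, ⟨ha 0 (Nat.zero_le _), hM⟩, fun _ => Nat.zero_le _⟩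
  | succ k ih =>
    have hkW : (k + 1) * W = k * W + W := by ring
    rcases ih (by omega) with ⟨j, hj, h⟩ | ⟨τ, hτ, hτk⟩
    · exact Or.inl ⟨j, by omega, h⟩
    set U : Finset α := Finset.univ.biUnion fun i => A (τ i) with hU
    -- The chain so far uses times up to `k * W`. Either the set at time `(k + 1) * W` is a return,
    -- or the set has left the union by at least `β` by then.
    by_cases hret : ((A ((k + 1) * W) \ U).card : ℝ) < β
    · exact Or.inl ⟨k, by omega, τ, (k + 1) * W, hk, hτ, fun i => by have := hτk i; omega, hret⟩
    right
    -- The next link is the first time after `τ 0` with at least `β` elements outside the union. One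
    -- step earlier there were fewer than `β`, and a step adds at most `β`, whence the bound `2 *
    -- β`.
    have hex : ∃ s, β ≤ ((A (τ 0 + s) \ U).card : ℝ) :=
      ⟨(k + 1) * W - τ 0, by
        have := hτk 0
        rw [show τ 0 + ((k + 1) * W - τ 0) = (k + 1) * W by omega]; exact not_lt.1 hret⟩
    classical
    have hs := Nat.find_spec hex
    have hmin : Nat.find hex ≤ (k + 1) * W - τ 0 := Nat.find_min' hex (by
        have := hτk 0
        rw [show τ 0 + ((k + 1) * W - τ 0) = (k + 1) * W by omega]; exact not_lt.1 hret)
    -- The first time is not `τ 0` itself, since that set is part of the union.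
    obtain ⟨s, hsS⟩ : ∃ s, Nat.find hex = s + 1 := by
      refine Nat.exists_eq_succ_of_ne_zero fun h0 => ?_
      rw [h0, add_zero, Finset.sdiff_eq_empty_iff_subset.2, Finset.card_empty, Nat.cast_zero] at hs
      · linarith
      · exact Finset.subset_biUnion_of_mem (fun i => A (τ i)) (Finset.mem_univ 0)
    have hprev := Nat.find_min hex (m := s) (by omega)
    rw [not_le] at hprev
    rw [hsS] at hs hmin
    have h0 := hτk 0
    refine ⟨Fin.cons (τ 0 + (s + 1)) τ, ⟨?_, ?_, ?_, ?_⟩, ?_⟩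
    · exact hτ
    · exact ha _ (by simp only [Fin.cons_zero]; omega)
    · exact hs
    · have hsub : A (τ 0 + (s + 1)) \ U ⊆
          (A (τ 0 + s) \ U) ∪ (A (τ 0 + s + 1) \ A (τ 0 + s)) := by
        intro x hx
        simp only [Finset.mem_sdiff, Finset.mem_union, ← add_assoc] at hx ⊢
        tauto
      have h1 := (Finset.card_le_card hsub).trans (Finset.card_union_le _ _)
      have h2 : ((A (τ 0 + (s + 1)) \ U).card : ℝ) ≤
        (A (τ 0 + s) \ U).card + (A (τ 0 + s + 1) \ A (τ 0 + s)).card := by exact_mod_cast h1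
      have h3 := hstep (τ 0 + s) (by omega)
      change ((A (τ 0 + (s + 1)) \ U).card : ℝ) ≤ 2 * β
      linarith
    · intro i
      refine Fin.cases ?_ (fun i => ?_) i
      · simp only [Fin.cons_zero]; omega
      · simp only [Fin.cons_succ]; have := hτk i; omega

end IncrementChain

/-! ### Pairs inside vertex sets -/

section Inside

variable {N : ℕ}

/-- The pairs with both ends in `S`. -/
def inside (S : Finset (Fin N)) : Finset (VertexPair N) :=
  Finset.univ.filter fun e => ∀ v ∈ (e : Sym2 (Fin N)), v ∈ S

theorem mem_inside {S : Finset (Fin N)} {e : VertexPair N} :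
    e ∈ inside S ↔ ∀ v ∈ (e : Sym2 (Fin N)), v ∈ S := by simp [inside]

theorem inside_mono {S S' : Finset (Fin N)} (h : S ⊆ S') : inside S ⊆ inside S' := fun _ he =>
  mem_inside.2 fun v hv => h (mem_inside.1 he v hv)

theorem inside_inter (S S' : Finset (Fin N)) : inside (S ∩ S') = inside S ∩ inside S' := by
  ext e
  simp only [mem_inside, Finset.mem_inter, ← forall_and]

theorem card_inside (S : Finset (Fin N)) :
    ((inside S).card : ℝ) = S.card * (S.card - 1) / 2 := by
  have h : (inside S).card = (S.offDiag.image Sym2.mk.uncurry).card := by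
    refine Finset.card_bij (fun e _ => (e : Sym2 (Fin N))) ?_ ?_ ?_
    · rintro ⟨e, he⟩ hS
      induction e with
      | _ x y =>
        rw [mem_inside] at hS
        refine Finset.mem_image.2 ⟨(x, y), ?_, rfl⟩
        exact Finset.mem_offDiag.2 ⟨hS x (Sym2.mem_mk_left _ _), hS y (Sym2.mem_mk_right _ _), he⟩
    · rintro e _ e' _ h; exact Subtype.ext h
    · rintro e he
      obtain ⟨⟨x, y⟩, hxy, rfl⟩ := Finset.mem_image.1 he
      obtain ⟨hx, hy, hne⟩ := Finset.mem_offDiag.1 hxy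
      refine ⟨⟨s(x, y), hne⟩, mem_inside.2 fun v hv => ?_, rfl⟩
      rcases Sym2.mem_iff.1 hv with rfl | rfl <;> assumption
  rw [h, Sym2.card_image_offDiag, Nat.cast_choose_two]

/-- The number of new pairs when a set is added to a family. -/
theorem card_biUnion_inside_ge {k : ℕ} (σ : Fin (k + 1 + 1) → Finset (Fin N)) {b : ℝ}
    (hb : b = (σ 0 \ Finset.univ.biUnion (Fin.tail σ)).card) :
    ((Finset.univ.biUnion fun i => inside (Fin.tail σ i)).card : ℝ)
      + b * ((σ 0).card - (b + 1) / 2)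
      ≤ (Finset.univ.biUnion fun i => inside (σ i)).card := by
  set U := Finset.univ.biUnion (Fin.tail σ)
  set E := Finset.univ.biUnion fun i => inside (Fin.tail σ i)
  have hE : E ⊆ inside U := Finset.biUnion_subset.2 fun i _ =>
    inside_mono (Finset.subset_biUnion_of_mem _ (Finset.mem_univ i))
  have h1 : (Finset.univ.biUnion fun i => inside (σ i)) = inside (σ 0) ∪ E := biUnion_fin_succ _
  -- Pairs in `σ 0` that are not inside `U` are new. With s = |σ 0| there are s(s-1)/2 -
  -- (s-b)(s-b-1)/2 = b(s - (b+1)/2) of them.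
  have hdisj : Disjoint E (inside (σ 0) \ inside U) :=
    Finset.disjoint_of_subset_left hE Finset.disjoint_sdiff
  have h2 : E ∪ (inside (σ 0) \ inside U) ⊆ inside (σ 0) ∪ E := by
    intro x; simp only [Finset.mem_union, Finset.mem_sdiff]; tauto
  have h3 := Finset.card_le_card h2
  rw [Finset.card_union_of_disjoint hdisj, ← h1] at h3
  have h4 := Finset.card_sdiff_add_card_inter (inside (σ 0)) (inside U)
  rw [← inside_inter] at h4
  have h5 := Finset.card_sdiff_add_card_inter (σ 0) U
  have h3' : (E.card : ℝ) + (inside (σ 0) \ inside U).card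
    ≤ (Finset.univ.biUnion fun i => inside (σ i)).card := by exact_mod_cast h3
  have h4' : ((inside (σ 0) \ inside U).card : ℝ) + (inside (σ 0 ∩ U)).card
    = (inside (σ 0)).card := by exact_mod_cast h4
  have h5' : ((σ 0 \ U).card : ℝ) + (σ 0 ∩ U).card = (σ 0).card := by exact_mod_cast h5
  rw [card_inside, card_inside] at h4'
  rw [← hb] at h5'
  have h6 : ((σ 0 ∩ U).card : ℝ) = (σ 0).card - b := by linarith
  rw [h6] at h4'
  nlinarith

end Inside

/-! ### Weighted counts of sets -/

section Counting

variable {N : ℕ}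

/-- The sum is a product over vertices. It replaces binomial estimates: choosing a set costs ℓ per
vertex outside `U`, up to a factor that is e^{O(Φ)} in the applications. -/
theorem sum_exp_card_sdiff_le (ℓ : ℝ) (U : Finset (Fin N)) :
    ∑ S : Finset (Fin N), Real.exp (-ℓ * (S \ U).card)
      ≤ Real.exp (U.card + N * Real.exp (-ℓ)) := by
  have h1 : ∀ S : Finset (Fin N), Real.exp (-ℓ * (S \ U).card)
      = ∏ i ∈ S, if i ∈ U then 1 else Real.exp (-ℓ) := by
    intro S
    rw [Finset.prod_ite, Finset.prod_const_one, one_mul, Finset.prod_const, mul_comm,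
      Real.exp_nat_mul, Finset.filter_notMem_eq_sdiff]
  have h2 := Finset.prod_one_add (f := fun i => if i ∈ U then 1 else Real.exp (-ℓ))
    (Finset.univ : Finset (Fin N))
  rw [Finset.powerset_univ] at h2
  simp only [h1, ← h2]
  have h3 : ∀ i : Fin N, 1 + (if i ∈ U then 1 else Real.exp (-ℓ))
      ≤ Real.exp ((if i ∈ U then 1 else 0) + Real.exp (-ℓ)) := by
    intro i
    have he := Real.exp_pos (-ℓ)
    split_ifs
    · linarith [Real.add_one_le_exp (1 + Real.exp (-ℓ))]
    · linarith [Real.add_one_le_exp (0 + Real.exp (-ℓ))]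
  refine (Finset.prod_le_prod (fun i _ => ?_) fun i _ => h3 i).trans ?_
  · have he := Real.exp_pos (-ℓ)
    split_ifs <;> linarith
  · rw [← Real.exp_sum, Finset.sum_add_distrib]
    simp

theorem sum_exp_card_le (ℓ : ℝ) :
    ∑ S : Finset (Fin N), Real.exp (-ℓ * S.card) ≤ Real.exp (N * Real.exp (-ℓ)) := by
  simpa using sum_exp_card_sdiff_le ℓ (∅ : Finset (Fin N))

end Counting

/-! ### First moment bounds -/

/-- Parameters for the first moment bounds: `p` is the edge probability, `ℓ` stands for `log d` and
`Φ` for `N * log d / d`. -/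
structure Regime (N : ℕ) (p ℓ Φ ι : ℝ) (K : ℕ) : Prop where
  p_nonneg : 0 ≤ p
  p_le_one : p ≤ 1
  iota_pos : 0 < ι
  one_le_Phi : 1 ≤ Φ
  p_mul_Phi : p * Φ = ℓ
  count : N * Real.exp (-ℓ) ≤ Φ
  -- With `length`, `K` links outweigh the initial factor e^{Φℓ/2}. The remaining fields make ℓ
  -- large enough for terms of order Φ to be absorbed by those of order Φℓ.
  length : 8 ≤ K * ι ^ 2
  ten_le : 10 ≤ ℓ
  one_le_mul : 1 ≤ ι * ℓ
  increment : 16 * (4 + K * ι / 2 + ι / 8) ≤ ι ^ 2 * ℓ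
  ret : 8 * (7 + K * ι / 2 + ι) ≤ ι * ℓ

namespace Regime

variable {N : ℕ} {p ℓ Φ ι : ℝ} {K : ℕ}

theorem sum_exp_card_le (h : Regime N p ℓ Φ ι K) :
    ∑ S : Finset (Fin N), Real.exp (-ℓ * S.card) ≤ Real.exp Φ :=
  (SparseIndep.sum_exp_card_le ℓ).trans (Real.exp_le_exp.2 h.count)

open Classical in
-- Here p|S| ≥ 3ℓ, so the cost of about p|S|²/2 ≥ (3/2)ℓ|S| exceeds the entropy ℓ|S|.
theorem sum_large_le (h : Regime N p ℓ Φ ι K) :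
    ∑ S : Finset (Fin N), (if 3 * Φ ≤ S.card then Real.exp (-(p * (inside S).card)) else 0)
      ≤ Real.exp (-(1 / 4) * (Φ * ℓ)) := by
  have hΦ := h.one_le_Phi
  have hℓ := h.ten_le
  have h1 : ∀ S : Finset (Fin N), (if 3 * Φ ≤ S.card then Real.exp (-(p * (inside S).card)) else 0)
      ≤ Real.exp (-(1 / 4) * (Φ * ℓ) - Φ) * Real.exp (-ℓ * S.card) := by
    intro S
    split_ifs with hS
    · rw [← Real.exp_add, Real.exp_le_exp, card_inside]
      set m : ℝ := (S.card : ℝ)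
      have hm : 3 * ℓ * m ≤ p * m * m := by
        have : 3 * ℓ ≤ p * m := by
          rw [← h.p_mul_Phi]; nlinarith [mul_le_mul_of_nonneg_left hS h.p_nonneg]
        exact mul_le_mul_of_nonneg_right this (by linarith)
      have hpm : p * m ≤ m := mul_le_of_le_one_left (by linarith) h.p_le_one
      nlinarith [mul_le_mul_of_nonneg_right hS (by linarith : (0 : ℝ) ≤ ℓ - 1)]
    · positivity
  refine (Finset.sum_le_sum fun S _ => h1 S).trans ?_
  rw [← Finset.mul_sum]
  refine (mul_le_mul_of_nonneg_left h.sum_exp_card_le (Real.exp_nonneg _)).trans ?_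
  rw [← Real.exp_add, sub_add_cancel]

/-- The weighted number of increment chains. -/
def chainSum (N : ℕ) (p Φ ι : ℝ) (k : ℕ) : ℝ := by
  classical
  exact ∑ σ : Fin (k + 1) → Finset (Fin N),
    if IncrementChain ((1 + ι) * Φ) (3 * Φ) (ι / 4 * Φ) k σ then
      Real.exp (-(p * (Finset.univ.biUnion fun i => inside (σ i)).card)) else 0

theorem chainSum_zero_le (h : Regime N p ℓ Φ ι K) :
    chainSum N p Φ ι 0 ≤ Real.exp (Φ * ℓ / 2 + 5 / 2 * Φ) := by
  classical
  unfold chainSum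
  rw [sum_fin_cons]
  simp only [Fintype.sum_unique]
  have h1 : ∀ S : Finset (Fin N),
      (if IncrementChain ((1 + ι) * Φ) (3 * Φ) (ι / 4 * Φ) 0 (Fin.cons S default) then
      Real.exp (-(p * (Finset.univ.biUnion fun i =>
        inside ((Fin.cons S default : Fin 1 → Finset (Fin N)) i)).card)) else 0)
      ≤ Real.exp (Φ * ℓ / 2 + 3 / 2 * Φ) * Real.exp (-ℓ * S.card) := by
    intro S
    split_ifs with hS
    · obtain ⟨-, hS⟩ := hS
      have hb : (Finset.univ.biUnion fun i =>
        inside ((Fin.cons S default : Fin 1 → Finset (Fin N)) i)) = inside S := by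
        rw [biUnion_fin_succ]; ext; simp
      rw [hb, ← Real.exp_add, Real.exp_le_exp, card_inside]
      simp only [Fin.cons_zero] at hS
      set m : ℝ := (S.card : ℝ)
      have hm0 : 0 ≤ m := Nat.cast_nonneg _
      have hpm : p * m ≤ m := mul_le_of_le_one_left hm0 h.p_le_one
      -- The exponent mℓ - pm²/2 is largest at m = Φ, with value Φℓ/2; this square is the deviation
      -- from the maximum.
      have hsq := mul_nonneg h.p_nonneg (sq_nonneg (m - Φ))
      have e1 : p * (m - Φ) ^ 2 = p * m * m - 2 * ℓ * m + Φ * ℓ := by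
        rw [← h.p_mul_Phi]; ring
      nlinarith
    · positivity
  refine (Finset.sum_le_sum fun S _ => h1 S).trans ?_
  rw [← Finset.mul_sum]
  refine (mul_le_mul_of_nonneg_left h.sum_exp_card_le (Real.exp_nonneg _)).trans ?_
  rw [← Real.exp_add, Real.exp_le_exp]
  linarith

theorem card_biUnion_le (h : Regime N p ℓ Φ ι K) {k : ℕ} (hk : k ≤ K)
    {σ : Fin (k + 1) → Finset (Fin N)}
    (hσ : IncrementChain ((1 + ι) * Φ) (3 * Φ) (ι / 4 * Φ) k σ) :
    ((Finset.univ.biUnion σ).card : ℝ) ≤ (3 + K * ι / 2) * Φ := by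
  have h1 := hσ.card_biUnion_le
  have h2 : (k : ℝ) ≤ K := by exact_mod_cast hk
  have h3 : 0 ≤ ι * Φ := mul_nonneg h.iota_pos.le (by linarith [h.one_le_Phi])
  nlinarith [mul_le_mul_of_nonneg_right h2 h3]

/-- With b new vertices, the new pairs cost at least b(ℓ + (3/4)ιℓ - 1/2), of which bℓ pays for the
choice of these vertices. As b ≥ ιΦ/4, about (3/16)ι²Φℓ is left; a third of it absorbs the terms of
order Φ. -/
theorem chainSum_succ_le (h : Regime N p ℓ Φ ι K) {k : ℕ} (hk : k + 1 ≤ K) :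
    chainSum N p Φ ι (k + 1) ≤ chainSum N p Φ ι k * Real.exp (-(ι ^ 2 / 8) * (Φ * ℓ)) := by
  classical
  have hΦ := h.one_le_Phi
  have hι := h.iota_pos
  have hℓ := h.ten_le
  unfold chainSum
  rw [sum_fin_cons, Finset.sum_comm, Finset.sum_mul]
  refine Finset.sum_le_sum fun σ _ => ?_
  by_cases hσ : IncrementChain ((1 + ι) * Φ) (3 * Φ) (ι / 4 * Φ) k σ
  swap
  · rw [if_neg hσ, zero_mul]
    exact (Finset.sum_eq_zero fun S _ => if_neg fun hc => hσ hc.1).le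
  rw [if_pos hσ]
  set U := Finset.univ.biUnion σ
  have hU : (U.card : ℝ) ≤ (3 + K * ι / 2) * Φ := h.card_biUnion_le (by omega) hσ
  have h1 : ∀ S : Finset (Fin N),
      (if IncrementChain ((1 + ι) * Φ) (3 * Φ) (ι / 4 * Φ) (k + 1) (Fin.cons S σ) then
      Real.exp (-(p * (Finset.univ.biUnion fun i =>
        inside ((Fin.cons S σ : Fin (k + 1 + 1) → Finset (Fin N)) i)).card)) else 0)
      ≤ Real.exp (-(p * (Finset.univ.biUnion fun i => inside (σ i)).card)) *
        Real.exp (-(ι / 4 * Φ * (3 / 4 * ι * ℓ - 1 / 2))) * Real.exp (-ℓ * (S \ U).card) := by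
    intro S
    split_ifs with hS
    · obtain ⟨-, ha, hb1, hb2⟩ := hS
      have hc := card_biUnion_inside_ge
        (Fin.cons S σ : Fin (k + 1 + 1) → Finset (Fin N)) (b := ((S \ U).card : ℝ)) rfl
      change ((Finset.univ.biUnion fun i => inside (σ i)).card : ℝ) +
        (S \ U).card * (S.card - ((S \ U).card + 1) / 2) ≤ _ at hc
      rw [← Real.exp_add, ← Real.exp_add, Real.exp_le_exp]
      change (1 + ι) * Φ ≤ S.card at ha
      change ι / 4 * Φ ≤ (S \ U).card at hb1
      change ((S \ U).card : ℝ) ≤ 2 * (ι / 4 * Φ) at hb2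
      set b : ℝ := ((S \ U).card : ℝ)
      set s : ℝ := (S.card : ℝ)
      have hc' := mul_le_mul_of_nonneg_left hc h.p_nonneg
      have hb0 : 0 ≤ b := Nat.cast_nonneg _
      have hps : ℓ + 3 / 4 * ι * ℓ - 1 / 2 ≤ p * (s - (b + 1) / 2) := by
        have e1 := mul_le_mul_of_nonneg_left ha h.p_nonneg
        have e2 := mul_le_mul_of_nonneg_left hb2 h.p_nonneg
        have e3 : p * ((1 + ι) * Φ) = (1 + ι) * ℓ := by rw [← h.p_mul_Phi]; ring
        have e4 : p * (2 * (ι / 4 * Φ)) = ι / 2 * ℓ := by rw [← h.p_mul_Phi]; ring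
        have := h.p_le_one
        linarith
      have h5 := mul_le_mul_of_nonneg_left hps hb0
      have h6 : 0 ≤ 3 / 4 * ι * ℓ - 1 / 2 := by linarith [h.one_le_mul]
      have h7 := mul_le_mul_of_nonneg_right hb1 h6
      linarith
    · positivity
  refine (Finset.sum_le_sum fun S _ => h1 S).trans ?_
  rw [← Finset.mul_sum, mul_assoc]
  refine mul_le_mul_of_nonneg_left ?_ (Real.exp_nonneg _)
  refine (mul_le_mul_of_nonneg_left (sum_exp_card_sdiff_le ℓ U) (Real.exp_nonneg _)).trans ?_
  rw [← Real.exp_add, Real.exp_le_exp]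
  have hi := mul_le_mul_of_nonneg_left h.increment (by linarith : (0 : ℝ) ≤ Φ)
  have hcount := h.count
  linarith

theorem chainSum_le (h : Regime N p ℓ Φ ι K) {k : ℕ} (hk : k ≤ K) :
    chainSum N p Φ ι k ≤ Real.exp (Φ * ℓ / 2 + 5 / 2 * Φ - k * (ι ^ 2 / 8 * (Φ * ℓ))) := by
  induction k with
  | zero => simpa using h.chainSum_zero_le
  | succ k ih =>
    refine (h.chainSum_succ_le hk).trans ((mul_le_mul_of_nonneg_right (ih (by omega))
      (Real.exp_nonneg _)).trans ?_)
    rw [← Real.exp_add, Real.exp_le_exp]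
    push_cast
    linarith

/-- Correlation allowed between the graphs at well separated times. -/
def decorrelation (ι : ℝ) : ℝ := ι / (1 + 2 * ι)

/-- The correlation is chosen so small that the returning set, of size (1 + 3ι/4)Φ, still costs more
than Φℓ/2. After multiplication by 1 + 2ι the two sides of the last inequality agree to first order
in ι. -/
theorem one_sub_decorrelation {ι : ℝ} (hι : 0 < ι) :
    0 ≤ 1 - decorrelation ι ∧ 1 - decorrelation ι ≤ 1 ∧
      1 + ι / 2 ≤ (1 - decorrelation ι) * (1 + 3 / 4 * ι) ^ 2 := by
  have h1 : 1 - decorrelation ι = (1 + ι) / (1 + 2 * ι) := by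
    unfold decorrelation; field_simp; ring
  rw [h1]
  refine ⟨by positivity, (div_le_one (by positivity)).2 (by linarith), ?_⟩
  rw [div_mul_eq_mul_div, le_div_iff₀ (by positivity)]
  have : 0 < ι ^ 2 := by positivity
  have : 0 < ι ^ 3 := by positivity
  nlinarith

open Classical in
-- Subsets of `U` number only e^{O(Φ)}, so almost the whole cost of an edgeless `S` remains. The
-- bound is shaped to cancel the factor e^{Φℓ/2 + 5Φ/2} of the chain.
theorem sum_return_le (h : Regime N p ℓ Φ ι K) {U : Finset (Fin N)}
    (hU : (U.card : ℝ) ≤ (3 + K * ι / 2) * Φ) :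
    ∑ S : Finset (Fin N), (if S ⊆ U ∧ (1 + 3 / 4 * ι) * Φ ≤ S.card then
      Real.exp (-((1 - decorrelation ι) * p * (inside S).card)) else 0)
      ≤ Real.exp (-(1 / 2 + ι / 8) * (Φ * ℓ) - 5 / 2 * Φ) := by
  have hΦ := h.one_le_Phi
  have hι := h.iota_pos
  have hℓ := h.ten_le
  obtain ⟨g0, g1, g2⟩ := one_sub_decorrelation hι
  set γ := 1 - decorrelation ι
  rw [← Finset.sum_filter]
  have hcard : ((Finset.univ.filter fun S : Finset (Fin N) =>
      S ⊆ U ∧ (1 + 3 / 4 * ι) * Φ ≤ S.card).card : ℝ) ≤ Real.exp U.card := by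
    have h1 : (Finset.univ.filter fun S : Finset (Fin N) =>
      S ⊆ U ∧ (1 + 3 / 4 * ι) * Φ ≤ S.card) ⊆ U.powerset := by
      intro S hS; exact Finset.mem_powerset.2 (Finset.mem_filter.1 hS).2.1
    have h2 := Finset.card_le_card h1
    rw [Finset.card_powerset] at h2
    calc _ ≤ ((2 ^ U.card : ℕ) : ℝ) := by exact_mod_cast h2
      _ = 2 ^ U.card := by push_cast; rfl
      _ ≤ Real.exp 1 ^ U.card :=
        pow_le_pow_left₀ (by norm_num) (by linarith [Real.add_one_le_exp (1 : ℝ)]) _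
      _ = Real.exp U.card := by rw [← Real.exp_nat_mul, mul_one]
  have hterm : ∀ S ∈ (Finset.univ.filter fun S : Finset (Fin N) =>
      S ⊆ U ∧ (1 + 3 / 4 * ι) * Φ ≤ S.card), Real.exp (-(γ * p * (inside S).card))
      ≤ Real.exp (-(1 / 2 + ι / 4) * (Φ * ℓ) + (1 + 3 / 4 * ι) / 2 * Φ) := by
    intro S hS
    obtain ⟨-, -, hS⟩ := Finset.mem_filter.1 hS
    rw [Real.exp_le_exp, card_inside]
    set m : ℝ := (S.card : ℝ)
    set m₀ : ℝ := (1 + 3 / 4 * ι) * Φ with hm₀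
    have hm1 : 1 ≤ m₀ := by nlinarith
    have e1 : m₀ * (m₀ - 1) ≤ m * (m - 1) := by nlinarith
    have e2 := mul_le_mul_of_nonneg_left e1 (mul_nonneg g0 h.p_nonneg)
    have e3 : γ * p * (m₀ * m₀) = γ * (1 + 3 / 4 * ι) ^ 2 * (Φ * ℓ) := by
      rw [← h.p_mul_Phi, hm₀]; ring
    have e4 : γ * p * m₀ ≤ m₀ := mul_le_of_le_one_left (by linarith)
      (mul_le_one₀ g1 h.p_nonneg h.p_le_one)
    have e5 := mul_le_mul_of_nonneg_right g2 (by positivity : 0 ≤ Φ * ℓ)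
    linarith
  refine (Finset.sum_le_card_nsmul _ _ _ hterm).trans ?_
  rw [nsmul_eq_mul]
  refine (mul_le_mul_of_nonneg_right hcard (Real.exp_nonneg _)).trans ?_
  rw [← Real.exp_add, Real.exp_le_exp]
  have hi := mul_le_mul_of_nonneg_left h.ret (by linarith : (0 : ℝ) ≤ Φ)
  have : 0 ≤ ι * Φ := by positivity
  linarith

end Regime

/-! ### Paths of stable successes -/

section Paths

variable {N : ℕ}

/-- The output on `y` is a large set without edges. -/
def Success (a : ℝ) (S : (VertexPair N → Bool) → Finset (Fin N)) (y : VertexPair N → Bool) : Prop :=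
  (∀ e ∈ inside (S y), y e = false) ∧ a ≤ (S y).card

/-- The outputs on both arguments are large sets without edges, and they are close. -/
def StableSuccess (a β : ℝ) (S : (VertexPair N → Bool) → Finset (Fin N))
    (y y' : VertexPair N → Bool) : Prop :=
  Success a S y ∧ Success a S y' ∧ ((symmDiff (S y) (S y')).card : ℝ) ≤ β

/-- Union bound over the three structures; the polynomial factor counts the choices of times. -/
theorem pathProb_stableSuccess_le {p ℓ Φ ι : ℝ} {K : ℕ} (h : Regime N p ℓ Φ ι K) {ε : ℝ}
    (e0 : 0 ≤ ε) (e1 : ε ≤ 1) {W n : ℕ} (hW0 : 0 < W) (hn : K * W ≤ n)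
    (hW : (1 - ε) ^ W ≤ Regime.decorrelation ι) (S : (VertexPair N → Bool) → Finset (Fin N)) :
    pathProb (prodBern p) (resample p ε) n (fun x => ∀ i : Fin n,
        StableSuccess ((1 + ι) * Φ) (ι / 4 * Φ) S (x i.castSucc) (x i.succ))
      ≤ (K + 2) * (n + 1) ^ (K + 1) * Real.exp (-(min (ι / 8) (1 / 4)) * (Φ * ℓ)) := by
  classical
  have hΦ := h.one_le_Phi
  have hι := h.iota_pos
  have hℓ := h.ten_le
  have hη : 0 ≤ Regime.decorrelation ι := by unfold Regime.decorrelation; positivity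
  have hK : 0 < K := by
    rcases Nat.eq_zero_or_pos K with rfl | hK
    · have := h.length; norm_num at this
    · exact hK
  have hμ := prodBern_nonneg (κ := VertexPair N) h.p_nonneg h.p_le_one
  have hR := resample_nonneg (κ := VertexPair N) h.p_nonneg h.p_le_one e0 e1
  -- The events forget `S` and keep only edgeless sets at given times, so that first moments apply:
  -- a very large set, a return, a long chain.
  let Q0 : (Fin (n + 1) → VertexPair N → Bool) → Prop := fun x =>
    ∃ B : Finset (Fin N), 3 * Φ ≤ B.card ∧ ∀ e ∈ inside B, x 0 e = false
  let Q1 : Fin K → (Fin (n + 1) → VertexPair N → Bool) → Prop := fun j x =>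
    ∃ τ : Fin (j + 1) → Fin (n + 1), ∃ t' : Fin (n + 1), ∃ σ : Fin (j + 1) → Finset (Fin N),
      ∃ B : Finset (Fin N),
      ((∀ i, (τ i : ℕ) + W ≤ t') ∧ IncrementChain ((1 + ι) * Φ) (3 * Φ) (ι / 4 * Φ) j σ ∧
        B ⊆ Finset.univ.biUnion σ ∧ (1 + 3 / 4 * ι) * Φ ≤ B.card) ∧
      ((∀ i, ∀ e ∈ inside (σ i), x (τ i) e = false) ∧ ∀ e ∈ inside B, x t' e = false)
  let Q2 : (Fin (n + 1) → VertexPair N → Bool) → Prop := fun x =>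
    ∃ τ : Fin (K + 1) → Fin (n + 1), ∃ σ : Fin (K + 1) → Finset (Fin N),
      IncrementChain ((1 + ι) * Φ) (3 * Φ) (ι / 4 * Φ) K σ ∧
      ((∀ i, ∀ e ∈ inside (σ i), x (τ i) e = false))
  have hcover : ∀ x : Fin (n + 1) → VertexPair N → Bool, (∀ i : Fin n,
      StableSuccess ((1 + ι) * Φ) (ι / 4 * Φ) S (x i.castSucc) (x i.succ)) →
      Q0 x ∨ (∃ j, Q1 j x) ∨ Q2 x := by
    intro x hx
    have hn0 : 0 < n := lt_of_lt_of_le (Nat.mul_pos hK hW0) hn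
    have hsucc : ∀ t : Fin (n + 1), Success ((1 + ι) * Φ) S (x t) := by
      intro t
      refine Fin.cases ?_ (fun i => (hx i).2.1) t
      exact (hx ⟨0, hn0⟩).1
    by_cases hlarge : 3 * Φ ≤ (S (x 0)).card
    · exact Or.inl ⟨S (x 0), hlarge, (hsucc 0).1⟩
    right
    let A : ℕ → Finset (Fin N) := fun t => S (x (Fin.ofNat (n + 1) t))
    have hval : ∀ t ≤ n, ((Fin.ofNat (n + 1) t : Fin (n + 1)) : ℕ) = t := fun t ht =>
      Nat.mod_eq_of_lt (by omega)
    have hstep : ∀ t < n, ((A (t + 1) \ A t).card : ℝ) ≤ ι / 4 * Φ := by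
      intro t ht
      have h1 := (hx ⟨t, ht⟩).2.2
      have h2 : Fin.ofNat (n + 1) t = Fin.castSucc ⟨t, ht⟩ := Fin.ext (hval t ht.le)
      have h3 : Fin.ofNat (n + 1) (t + 1) = Fin.succ ⟨t, ht⟩ := Fin.ext (hval (t + 1) ht)
      simp only [A, h2, h3]
      refine le_trans ?_ h1
      exact_mod_cast Finset.card_le_card (fun v hv => Finset.mem_symmDiff.2
        (Or.inr (Finset.mem_sdiff.1 hv)))
    rcases exists_incrementChain_or_return (A := A) (T := n) (a := (1 + ι) * Φ) (M := 3 * Φ)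
      (by positivity : 0 < ι / 4 * Φ) hW0 (fun t _ => (hsucc _).2) (le_of_not_ge hlarge) hstep K hn
      with ⟨j, hj, τ, t', ht', hch, hfar, hret⟩ | ⟨τ, hch, -⟩
    -- The witness for the return is the part of `A t'` inside the union, of size at least (1+ι)Φ -
    -- ιΦ/4.
    · refine Or.inl ⟨⟨j, hj⟩, fun i => Fin.ofNat (n + 1) (τ i), Fin.ofNat (n + 1) t',
        fun i => A (τ i), A t' ∩ Finset.univ.biUnion fun i => A (τ i),
        ⟨fun i => ?_, hch, Finset.inter_subset_right, ?_⟩, fun i => (hsucc _).1, fun e he => ?_⟩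
      · have := hfar i
        rw [hval _ ht', hval _ (by omega)]; exact this
      · have h1 := Finset.card_sdiff_add_card_inter (A t') (Finset.univ.biUnion fun i => A (τ i))
        have h2 : ((A t' \ Finset.univ.biUnion fun i => A (τ i)).card : ℝ) +
          (A t' ∩ Finset.univ.biUnion fun i => A (τ i)).card = (A t').card := by exact_mod_cast h1
        have h3 : (1 + ι) * Φ ≤ (A t').card := (hsucc _).2
        linarith
      · exact (hsucc _).1 e (inside_mono Finset.inter_subset_left he)
    · exact Or.inr ⟨fun i => Fin.ofNat (n + 1) (τ i), fun i => A (τ i), hch, fun i => (hsucc _).1⟩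
  set c : ℝ := min (ι / 8) (1 / 4)
  have hc1 : c ≤ ι / 8 := min_le_left _ _
  have hc2 : c ≤ 1 / 4 := min_le_right _ _
  have hΛ : 0 ≤ Φ * ℓ := by positivity
  have hn1 : (1 : ℝ) ≤ n + 1 := by linarith [Nat.cast_nonneg (α := ℝ) n]
  have hE : Real.exp (-(1 / 4) * (Φ * ℓ)) ≤ Real.exp (-c * (Φ * ℓ)) := by
    rw [Real.exp_le_exp]; nlinarith
  have hnn : ∀ (R : ℝ), 0 ≤ Real.exp R := fun R => Real.exp_nonneg R
  -- a very large set
  have b0 : pathProb (prodBern p) (resample p ε) n Q0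
      ≤ (n + 1) ^ (K + 1) * Real.exp (-c * (Φ * ℓ)) := by
    refine (pathProb_exists_le hμ hR _).trans (le_trans ?_ (hE.trans
      (le_mul_of_one_le_left (hnn _) (one_le_pow₀ hn1))))
    refine le_trans (Finset.sum_le_sum fun B _ => ?_) h.sum_large_le
    rw [pathProb_const_and]
    split_ifs
    · have := pathProb_vanish_le (κ := VertexPair N) h.p_nonneg h.p_le_one e0 e1 (n := n) hη hW
        (J := Fin 1) (fun _ => 0) (fun _ => inside B) 0 ∅ (by simp)
      refine le_trans (pathProb_mono hμ hR fun x hx => ⟨fun _ => hx, by simp⟩) (this.trans ?_)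
      simp
    · exact le_rfl
  -- a long chain
  have b2 : pathProb (prodBern p) (resample p ε) n Q2
      ≤ (n + 1) ^ (K + 1) * Real.exp (-c * (Φ * ℓ)) := by
    refine (pathProb_exists_le hμ hR _).trans ?_
    have h1 : ∀ τ : Fin (K + 1) → Fin (n + 1), pathProb (prodBern p) (resample p ε) n
        (fun x => ∃ σ : Fin (K + 1) → Finset (Fin N),
          IncrementChain ((1 + ι) * Φ) (3 * Φ) (ι / 4 * Φ) K σ ∧
          ((∀ i, ∀ e ∈ inside (σ i), x (τ i) e = false))) ≤ Real.exp (-c * (Φ * ℓ)) := by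
      intro τ
      refine (pathProb_exists_le hμ hR _).trans ?_
      refine le_trans (b := Regime.chainSum N p Φ ι K) ?_ ((h.chainSum_le le_rfl).trans
        (le_trans ?_ hE))
      · refine Finset.sum_le_sum fun σ _ => ?_
        rw [pathProb_const_and]
        split_ifs
        · have := pathProb_vanish_le (κ := VertexPair N) h.p_nonneg h.p_le_one e0 e1 (n := n) hη hW
            τ (fun i => inside (σ i)) 0 ∅ (by simp)
          refine le_trans (pathProb_mono hμ hR fun x hx => ⟨hx, by simp⟩) (this.trans ?_)
          simp
        · exact le_rfl
      · rw [Real.exp_le_exp]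
        have := mul_le_mul_of_nonneg_right h.length hΛ
        nlinarith
    refine (Finset.sum_le_card_nsmul _ _ _ fun τ _ => h1 τ).trans ?_
    simp
  -- a return
  have b1 : ∀ j : Fin K, pathProb (prodBern p) (resample p ε) n (Q1 j)
      ≤ (n + 1) ^ (K + 1) * Real.exp (-c * (Φ * ℓ)) := by
    intro j
    refine (pathProb_exists_le hμ hR _).trans ?_
    have h1 : ∀ (τ : Fin (j + 1) → Fin (n + 1)) (t' : Fin (n + 1)),
        pathProb (prodBern p) (resample p ε) n (fun x => ∃ σ : Fin (j + 1) → Finset (Fin N),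
        ∃ B : Finset (Fin N),
        ((∀ i, (τ i : ℕ) + W ≤ t') ∧ IncrementChain ((1 + ι) * Φ) (3 * Φ) (ι / 4 * Φ) j σ ∧
          B ⊆ Finset.univ.biUnion σ ∧ (1 + 3 / 4 * ι) * Φ ≤ B.card) ∧
        ((∀ i, ∀ e ∈ inside (σ i), x (τ i) e = false) ∧ ∀ e ∈ inside B, x t' e = false))
        ≤ Real.exp (-c * (Φ * ℓ)) := by
      intro τ t'
      refine (pathProb_exists_le hμ hR _).trans ?_
      refine le_trans (b := Regime.chainSum N p Φ ι j *
        Real.exp (-(1 / 2 + ι / 8) * (Φ * ℓ) - 5 / 2 * Φ)) ?_ ?_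
      · unfold Regime.chainSum
        rw [Finset.sum_mul]
        refine Finset.sum_le_sum fun σ _ => (pathProb_exists_le hμ hR _).trans ?_
        split_ifs with hσ
        · have hret := mul_le_mul_of_nonneg_left (h.sum_return_le (h.card_biUnion_le j.2.le hσ))
            (hnn (-(p * (Finset.univ.biUnion fun i => inside (σ i)).card)))
          rw [Finset.mul_sum] at hret
          refine le_trans (Finset.sum_le_sum fun B _ => ?_) hret
          rw [pathProb_const_and]
          split_ifs with hB hB' hB'
          · rw [← Real.exp_add]
            refine (pathProb_vanish_le (κ := VertexPair N) h.p_nonneg h.p_le_one e0 e1 (n := n)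
              hη hW τ (fun i => inside (σ i)) t' (inside B) (fun _ => hB.1)).trans ?_
            rw [sub_eq_add_neg]
          · exact absurd hB.2.2 hB'
          · rw [← Real.exp_add]; exact hnn _
          · simp
        · rw [zero_mul]
          refine (Finset.sum_eq_zero fun B _ => ?_).le
          rw [pathProb_const_and, if_neg fun hc => hσ hc.2.1]
      · refine (mul_le_mul_of_nonneg_right (h.chainSum_le j.2.le) (hnn _)).trans ?_
        rw [← Real.exp_add, Real.exp_le_exp]
        -- The gain from the links is dropped: the initial factor e^{Φℓ/2 + 5Φ/2} already loses
        -- against the return.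
        have : 0 ≤ (j : ℝ) * (ι ^ 2 / 8 * (Φ * ℓ)) := by positivity
        nlinarith
    have h2 : ∀ τ : Fin (j + 1) → Fin (n + 1), pathProb (prodBern p) (resample p ε) n
        (fun x => ∃ t' : Fin (n + 1), ∃ σ : Fin (j + 1) → Finset (Fin N), ∃ B : Finset (Fin N),
        ((∀ i, (τ i : ℕ) + W ≤ t') ∧ IncrementChain ((1 + ι) * Φ) (3 * Φ) (ι / 4 * Φ) j σ ∧
          B ⊆ Finset.univ.biUnion σ ∧ (1 + 3 / 4 * ι) * Φ ≤ B.card) ∧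
        ((∀ i, ∀ e ∈ inside (σ i), x (τ i) e = false) ∧ ∀ e ∈ inside B, x t' e = false))
        ≤ (n + 1) * Real.exp (-c * (Φ * ℓ)) := by
      intro τ
      refine (pathProb_exists_le hμ hR _).trans
        ((Finset.sum_le_card_nsmul _ _ _ fun t' _ => h1 τ t').trans ?_)
      simp
    refine (Finset.sum_le_card_nsmul _ _ _ fun τ _ => h2 τ).trans ?_
    rw [nsmul_eq_mul, ← mul_assoc]
    refine mul_le_mul_of_nonneg_right ?_ (hnn _)
    have h3 : (((Finset.univ : Finset (Fin (j + 1) → Fin (n + 1))).card : ℕ) : ℝ)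
        = (n + 1) ^ (j + 1 : ℕ) := by simp
    rw [h3, ← pow_succ]
    exact pow_le_pow_right₀ hn1 (by have := j.2; omega)
  refine (pathProb_mono hμ hR hcover).trans ?_
  refine (pathProb_or_le hμ hR _ _).trans ?_
  have h4 := pathProb_or_le hμ hR (n := n) (fun x => ∃ j, Q1 j x) Q2
  have h5 := (pathProb_exists_le hμ hR (n := n) Q1).trans
    (Finset.sum_le_card_nsmul _ _ _ fun j _ => b1 j)
  simp only [Finset.card_univ, Fintype.card_fin, nsmul_eq_mul] at h5
  have h6 : pathProb (prodBern p) (resample p ε) n (fun x => (∃ j, Q1 j x) ∨ Q2 x) ≤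
    K * ((n + 1) ^ (K + 1) * Real.exp (-c * (Φ * ℓ))) +
      (n + 1) ^ (K + 1) * Real.exp (-c * (Φ * ℓ)) := h4.trans (add_le_add h5 b2)
  linarith

end Paths

/-! ### Lower bound for the probability of stable paths -/

section Stable

variable {N : ℕ}

theorem stableSuccess_comm {a β : ℝ} {S : (VertexPair N → Bool) → Finset (Fin N)}
    {y y' : VertexPair N → Bool} : StableSuccess a β S y y' ↔ StableSuccess a β S y' y := by
  unfold StableSuccess
  rw [symmDiff_comm]
  tauto

open Classical in
/-- A function that is successful with probability `π` and stable is successful and stable along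
long paths. -/
theorem pow_le_pathProb_stableSuccess {p ε : ℝ} (h0 : 0 ≤ p) (h1 : p ≤ 1) (e0 : 0 ≤ ε)
    (e1 : ε ≤ 1) {a β π : ℝ} (hβ : 0 < β) (hπ : 0 ≤ π)
    (S : (VertexPair N → Bool) → Finset (Fin N))
    (hS : π ≤ ∑ y, prodBern p y * if Success a S y then 1 else 0)
    (hst : ∑ y, ∑ y', prodBern p y * resample p ε y y' * ((symmDiff (S y) (S y')).card : ℝ)
      ≤ π ^ 2 / 2 * β) (m : ℕ) :
    (π ^ 2 / 2) ^ 2 ^ m ≤ pathProb (prodBern p) (resample p ε) (2 ^ m) (fun x =>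
      ∀ i : Fin (2 ^ m), StableSuccess a β S (x i.castSucc) (x i.succ)) := by
  have hR := resample_nonneg (κ := VertexPair N) h0 h1 e0 e1
  have hμ := prodBern_nonneg (κ := VertexPair N) h0 h1
  rw [← pathMass_ite_eq_pathProb]
  refine le_trans (pow_le_pow_left₀ (by positivity) ?_ _)
    (pathMass_one_pow_le hμ (sum_prodBern p) (fun y y' => by
      split_ifs
      · exact hR _ _
      · exact le_rfl) (fun y y' => ?_) m)
  · have hpair : π ^ 2 ≤ ∑ y, ∑ y', prodBern p y * resample p ε y y' *
        ((if Success a S y then (1 : ℝ) else 0) * if Success a S y' then 1 else 0) :=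
      (pow_le_pow_left₀ hπ hS 2).trans (sq_sum_le_sum_resample h0 h1 e1 _)
    -- If both outputs succeed without being close, then |symmDiff|/β exceeds 1, so Markov's
    -- inequality controls this case.
    have hterm : ∀ y y', prodBern p y * resample p ε y y' *
        ((if Success a S y then (1 : ℝ) else 0) * if Success a S y' then 1 else 0)
        ≤ prodBern p y * (if StableSuccess a β S y y' then resample p ε y y' else 0)
          + prodBern p y * resample p ε y y' * ((symmDiff (S y) (S y')).card : ℝ) / β := by
      intro y y'
      have hw : 0 ≤ prodBern p y * resample p ε y y' := mul_nonneg (hμ y) (hR y y')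
      have hc : 0 ≤ prodBern p y * resample p ε y y' * ((symmDiff (S y) (S y')).card : ℝ) / β := by
        positivity
      by_cases hy : Success a S y <;> by_cases hy' : Success a S y'
      · by_cases hd : ((symmDiff (S y) (S y')).card : ℝ) ≤ β
        · rw [if_pos hy, if_pos hy', if_pos ⟨hy, hy', hd⟩]
          linarith
        · rw [if_pos hy, if_pos hy', if_neg (fun h => hd h.2.2), mul_zero, zero_add, mul_div_assoc]
          refine mul_le_mul_of_nonneg_left ?_ hw
          rw [one_mul, one_le_div hβ]
          exact (not_le.1 hd).le
      all_goals
        rw [if_neg (fun h : StableSuccess a β S y y' => by first | exact hy' h.2.1 | exact hy h.1)]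
        simp only [hy, hy', if_true, if_false, mul_zero, zero_mul, zero_add]
        exact hc
    have hsum := hpair.trans (Finset.sum_le_sum fun y _ => Finset.sum_le_sum fun y' _ => hterm y y')
    simp only [Finset.sum_add_distrib, ← Finset.sum_div] at hsum
    have hst' : (∑ y, ∑ y', prodBern p y * resample p ε y y' *
        ((symmDiff (S y) (S y')).card : ℝ)) / β ≤ π ^ 2 / 2 := by
      rw [div_le_iff₀ hβ]; exact hst
    have hmass : pathMass (prodBern p) (fun y y' => if StableSuccess a β S y y' then
        resample p ε y y' else 0) 1 = ∑ y, ∑ y', prodBern p y *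
        (if StableSuccess a β S y y' then resample p ε y y' else 0) := by
      simp only [pathMass, backward, one_mul, mul_one, Finset.mul_sum]
    rw [hmass]
    linarith
  · by_cases h : StableSuccess a β S y y'
    · rw [if_pos h, if_pos (stableSuccess_comm.1 h)]
      exact prodBern_mul_resample p ε y y'
    · rw [if_neg h, if_neg (fun h' => h (stableSuccess_comm.1 h')), mul_zero, mul_zero]

end Stable

/-! ### Asymptotics -/

theorem eventually_mul_add_one_le {D : ℕ → ℕ}
    (hD : (fun N : ℕ => (D N : ℝ)) =o[atTop] (fun N : ℕ => (N : ℝ))) (B : ℝ) {s : ℝ} (hs : 0 < s) :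
    ∀ᶠ N : ℕ in atTop, B * (D N + 1) ≤ s * N := by
  have hB : 0 < |B| + 1 := by positivity
  have h1 := hD.def (show 0 < s / (2 * (|B| + 1)) by positivity)
  have h2 : ∀ᶠ N : ℕ in atTop, 2 * (|B| + 1) / s ≤ N :=
    tendsto_natCast_atTop_atTop.eventually_ge_atTop _
  filter_upwards [h1, h2] with N h1 h2
  rw [Real.norm_of_nonneg (Nat.cast_nonneg _), Real.norm_of_nonneg (Nat.cast_nonneg _)] at h1
  rw [div_le_iff₀ hs] at h2
  have h3 : (|B| + 1) * D N ≤ s * N / 2 := by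
    calc (|B| + 1) * D N ≤ (|B| + 1) * (s / (2 * (|B| + 1)) * N) :=
          mul_le_mul_of_nonneg_left h1 hB.le
      _ = s * N / 2 := by field_simp
  have h4 : B * (D N + 1) ≤ (|B| + 1) * (D N + 1) :=
    mul_le_mul_of_nonneg_right (by linarith [le_abs_self B]) (by positivity)
  nlinarith

theorem eventually_regime {ι : ℝ} (hι : 0 < ι) :
    ∃ dStar : ℝ, 1 < dStar ∧ ∀ d : ℝ, dStar ≤ d → ∀ᶠ N : ℕ in atTop,
      Regime N (d / N) (Real.log d) (Real.log d / d * N) ι ⌈8 / ι ^ 2⌉₊ := by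
  set K := ⌈8 / ι ^ 2⌉₊
  set L : ℝ := 10 + 1 / ι + 16 * (4 + K * ι / 2 + ι / 8) / ι ^ 2 + 8 * (7 + K * ι / 2 + ι) / ι
  have t1 : 0 ≤ 1 / ι := by positivity
  have t2 : 0 ≤ 16 * (4 + K * ι / 2 + ι / 8) / ι ^ 2 := by positivity
  have t3 : 0 ≤ 8 * (7 + K * ι / 2 + ι) / ι := by positivity
  have hL : 10 ≤ L := by linarith
  refine ⟨Real.exp L, Real.one_lt_exp_iff.2 (by linarith), fun d hd => ?_⟩
  have hd0 : 0 < d := (Real.exp_pos L).trans_le hd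
  have hℓ : L ≤ Real.log d := (Real.le_log_iff_exp_le hd0).2 hd
  have hℓ0 : 0 < Real.log d := by linarith
  have e1 : ∀ᶠ N : ℕ in atTop, d ≤ N := tendsto_natCast_atTop_atTop.eventually_ge_atTop _
  have e2 : ∀ᶠ N : ℕ in atTop, d / Real.log d ≤ N :=
    tendsto_natCast_atTop_atTop.eventually_ge_atTop _
  filter_upwards [e1, e2] with N e1 e2
  have hN : (0 : ℝ) < N := hd0.trans_le e1
  refine ⟨by positivity, (div_le_one hN).2 e1, hι, ?_, by field_simp, ?_, ?_, by linarith, ?_, ?_, ?_⟩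
  · rw [div_le_iff₀ hℓ0] at e2
    rw [div_mul_eq_mul_div, one_le_div hd0]; linarith
  · rw [Real.exp_neg, Real.exp_log hd0, div_mul_eq_mul_div, ← div_eq_mul_inv]
    gcongr
    exact le_mul_of_one_le_left hN.le (by linarith)
  · exact (div_le_iff₀ (by positivity)).1 (Nat.le_ceil (8 / ι ^ 2))
  · have : 1 / ι ≤ Real.log d := by linarith
    rw [div_le_iff₀ hι] at this; linarith
  · have : 16 * (4 + K * ι / 2 + ι / 8) / ι ^ 2 ≤ Real.log d := by linarith
    rw [div_le_iff₀ (by positivity)] at this; linarith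
  · have : 8 * (7 + K * ι / 2 + ι) / ι ≤ Real.log d := by linarith
    rw [div_le_iff₀ hι] at this; linarith

open Classical in
/-- Functions which are stable under resampling `o(N)` many times do not find large independent
sets with positive probability. -/
theorem eventually_not_stable {ι : ℝ} (hι : 0 < ι) :
    ∃ dStar : ℝ, 1 < dStar ∧ ∀ d : ℝ, dStar ≤ d → ∀ (D : ℕ → ℕ),
      (fun N : ℕ => (D N : ℝ)) =o[atTop] (fun N : ℕ => (N : ℝ)) →
      ∀ π : ℝ, 0 < π → π ≤ 1 → ∀ c₀ : ℝ, 0 < c₀ → c₀ ≤ 1 → ∀ᶠ N : ℕ in atTop,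
        ∀ S : (VertexPair N → Bool) → Finset (Fin N),
          π ≤ (∑ y, prodBern (d / N) y *
            if Success ((1 + ι) * (Real.log d / d * N)) S y then 1 else 0) →
          π ^ 2 / 2 * (ι / 4 * (Real.log d / d * N)) < ∑ y, ∑ y', prodBern (d / N) y *
            resample (d / N) (c₀ / (D N + 1)) y y' * ((symmDiff (S y) (S y')).card : ℝ) := by
  obtain ⟨dStar, hd1, hreg⟩ := eventually_regime hι
  refine ⟨dStar, hd1, fun d hd D hD π hπ hπ1 c₀ hc₀ hc₁ => ?_⟩
  set K := ⌈8 / ι ^ 2⌉₊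
  have hK : 0 < K := Nat.ceil_pos.2 (by positivity)
  have hd0 : 0 < d := by linarith
  have hℓ0 : 0 < Real.log d := Real.log_pos (by linarith)
  set c : ℝ := min (ι / 8) (1 / 4) * (Real.log d / d * Real.log d)
  have hc : 0 < c := by
    have : 0 < min (ι / 8) (1 / 4 : ℝ) := lt_min (by positivity) (by norm_num)
    positivity
  set η := Regime.decorrelation ι
  have hη : 0 < η := by simp only [η, Regime.decorrelation]; positivity
  have hη1 : η ≤ 1 := by linarith [(Regime.one_sub_decorrelation hι).1]
  have hlogη : 0 ≤ -Real.log η := neg_nonneg.2 (Real.log_nonpos hη.le hη1)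
  set q := -Real.log (π ^ 2 / 2)
  have hQ : 0 < π ^ 2 / 2 := by positivity
  -- The path length will be at most `B * (D N + 1)`, which is o(N).
  set B : ℝ := 2 * K * (-Real.log η / c₀ + 2)
  have ev1 : ∀ᶠ N : ℕ in atTop, (q * B) * (D N + 1) ≤ c / 3 * N :=
    eventually_mul_add_one_le hD _ (by positivity)
  have ev2 : ∀ᶠ N : ℕ in atTop, (B + 1) * (D N + 1) ≤ 1 * N :=
    eventually_mul_add_one_le hD _ one_pos
  have ev3 : ∀ᶠ N : ℕ in atTop, ((K : ℝ) + 2) * (N : ℝ) ^ (K + 1) < Real.exp (c / 3 * N) := by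
    have h1 := (isLittleO_pow_exp_pos_mul_atTop (k := K + 1) (b := c / 3) (by positivity)).def
      (show (0 : ℝ) < 1 / (2 * (K + 2)) by positivity)
    filter_upwards [tendsto_natCast_atTop_atTop.eventually h1] with N h1
    rw [Real.norm_of_nonneg (by positivity), Real.norm_of_nonneg (Real.exp_nonneg _)] at h1
    have h2 := Real.exp_pos (c / 3 * N)
    calc ((K : ℝ) + 2) * (N : ℝ) ^ (K + 1)
        ≤ (K + 2) * (1 / (2 * (K + 2)) * Real.exp (c / 3 * N)) :=
          mul_le_mul_of_nonneg_left h1 (by positivity)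
      _ = Real.exp (c / 3 * N) / 2 := by field_simp
      _ < _ := by linarith
  filter_upwards [hreg d hd, ev1, ev2, ev3] with N hreg ev1 ev2 ev3 S hS
  by_contra! hst
  set ε : ℝ := c₀ / (D N + 1) with hε
  have hD1 : (1 : ℝ) ≤ D N + 1 := by linarith [Nat.cast_nonneg (α := ℝ) (D N)]
  have e0 : 0 < ε := by positivity
  have e1 : ε ≤ 1 := (div_le_one (by positivity)).2 (hc₁.trans hD1)
  -- Enough steps for (1-ε)^W ≤ e^{-εW} ≤ η; the added 1 makes `W` positive.
  set W : ℕ := ⌈-Real.log η / ε⌉₊ + 1 with hWdef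
  have hWlow : -Real.log η ≤ ε * W := by
    have := Nat.le_ceil (-Real.log η / ε)
    rw [div_le_iff₀ e0] at this
    rw [hWdef]; push_cast; linarith
  have hWhigh : (W : ℝ) ≤ (-Real.log η / c₀ + 2) * (D N + 1) := by
    have h1 := (Nat.ceil_lt_add_one (div_nonneg hlogη e0.le)).le
    have h2 : -Real.log η / ε = -Real.log η / c₀ * (D N + 1) := by rw [hε]; field_simp
    rw [h2] at h1
    rw [hWdef]; push_cast
    rw [h2]
    linarith
  have hWη : (1 - ε) ^ W ≤ η := by
    calc (1 - ε) ^ W ≤ Real.exp (-ε) ^ W :=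
          pow_le_pow_left₀ (by linarith) (by linarith [Real.add_one_le_exp (-ε)]) _
      _ = Real.exp (W * -ε) := by rw [Real.exp_nat_mul]
      _ ≤ Real.exp (Real.log η) := Real.exp_le_exp.2 (by linarith)
      _ = η := Real.exp_log hη
  -- The doubling argument needs a power of two as path length; this one lies between KW and 2KW.
  set m := Nat.log 2 (K * W) + 1
  have hm1 : K * W ≤ 2 ^ m := (Nat.lt_pow_succ_log_self (by norm_num) _).le
  have hm2 : ((2 ^ m : ℕ) : ℝ) ≤ B * (D N + 1) := by
    have h1 : 2 ^ m ≤ 2 * (K * W) := by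
      have := Nat.pow_log_le_self 2 (Nat.mul_pos hK (Nat.succ_pos _) : 0 < K * W).ne'
      rw [pow_succ]; omega
    calc ((2 ^ m : ℕ) : ℝ) ≤ 2 * (K * W) := by exact_mod_cast h1
      _ ≤ 2 * (K * ((-Real.log η / c₀ + 2) * (D N + 1))) := by gcongr
      _ = B * (D N + 1) := by simp only [B]; ring
  have hΦ := hreg.one_le_Phi
  have hlow := pow_le_pathProb_stableSuccess hreg.p_nonneg hreg.p_le_one e0.le e1
    (by positivity : 0 < ι / 4 * (Real.log d / d * N)) hπ.le S hS hst m
  have hup := pathProb_stableSuccess_le hreg e0.le e1 (Nat.succ_pos _ : 0 < W) hm1 hWη S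
  have hcomb := hlow.trans hup
  have hq0 : 0 ≤ q := neg_nonneg.2 (Real.log_nonpos hQ.le (by nlinarith))
  have hl : Real.exp (-(c / 3 * N)) ≤ (π ^ 2 / 2) ^ 2 ^ m := by
    rw [← Real.exp_log hQ, ← Real.exp_nat_mul, Real.exp_le_exp]
    have h1 := mul_le_mul_of_nonneg_left hm2 hq0
    have h2 : ((2 ^ m : ℕ) : ℝ) * Real.log (π ^ 2 / 2) = -(q * ((2 ^ m : ℕ) : ℝ)) := by
      simp only [q]; ring
    rw [h2]
    linarith
  have hu : ((K : ℝ) + 2) * ((2 ^ m : ℕ) + 1) ^ (K + 1) *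
      Real.exp (-(min (ι / 8) (1 / 4)) * (Real.log d / d * N * Real.log d))
      < Real.exp (c / 3 * N) * Real.exp (-(c * N)) := by
    have h1 : -(min (ι / 8) (1 / 4)) * (Real.log d / d * N * Real.log d) = -(c * N) := by
      simp only [c]; ring
    rw [h1]
    refine mul_lt_mul_of_pos_right (lt_of_le_of_lt ?_ ev3) (Real.exp_pos _)
    have h2 : ((2 ^ m : ℕ) : ℝ) + 1 ≤ N := by linarith
    gcongr
  -- The two bounds give e^{-cN/3} < e^{cN/3 - cN}, which is absurd.
  have hfin := hl.trans_lt (hcomb.trans_lt hu)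
  rw [← Real.exp_add, Real.exp_lt_exp] at hfin
  have hN : (0 : ℝ) ≤ N := Nat.cast_nonneg _
  have : 0 ≤ c * N := by positivity
  linarith

/-! ### The random graph as a finite weighted sum -/

section Law

variable {N : ℕ}

instance : MeasurableSingletonClass (SimpleGraph (Fin N)) where
  measurableSet_singleton G := by
    have : ({G} : Set (SimpleGraph (Fin N))) = SimpleGraph.edgeSet ⁻¹' {G.edgeSet} := by
      ext H; simp
    rw [this]
    exact SimpleGraph.measurable_edgeSet (measurableSet_singleton _)

theorem edgeVector_bijective : Function.Bijective (edgeVector (N := N)) := by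
  constructor
  · intro G H h
    apply SimpleGraph.edgeSet_injective
    ext e
    by_cases he : e.IsDiag
    · exact ⟨fun h => absurd he (SimpleGraph.not_isDiag_of_mem_edgeSet _ h),
        fun h => absurd he (SimpleGraph.not_isDiag_of_mem_edgeSet _ h)⟩
    · simpa [edgeVector] using congrFun h ⟨e, he⟩
  · intro y
    refine ⟨SimpleGraph.fromEdgeSet {e | ∃ h : ¬ e.IsDiag, y ⟨e, h⟩ = true}, ?_⟩
    funext ⟨e, he⟩
    simp [edgeVector, he]

theorem sparseGraph_singleton {d : ℝ} (h0 : 0 ≤ d / N) (h1 : d / N ≤ 1)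
    (G : SimpleGraph (Fin N)) :
    sparseGraph N d {G} = ENNReal.ofReal (prodBern (d / N) (edgeVector G)) := by
  classical
  have hp : Set.projIcc (0 : ℝ) 1 zero_le_one (d / N) = ⟨d / N, h0, h1⟩ :=
    Set.projIcc_of_mem zero_le_one ⟨h0, h1⟩
  have hcard : G.edgeSet.ncard
      = (Finset.univ.filter fun e : VertexPair N => edgeVector G e = true).card := by
    rw [← Set.ncard_coe_finset]
    refine (Set.ncard_congr (fun (e : VertexPair N) _ => (e : Sym2 (Fin N))) ?_ ?_ ?_).symm
    · intro e he; simpa [edgeVector] using he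
    · intro e e' _ _ h; exact Subtype.ext h
    · intro e he
      exact ⟨⟨e, SimpleGraph.not_isDiag_of_mem_edgeSet _ he⟩, by simpa [edgeVector] using he, rfl⟩
  have hcompl : (Nat.card (Fin N)).choose 2 - G.edgeSet.ncard
      = (Finset.univ.filter fun e : VertexPair N => ¬ edgeVector G e = true).card := by
    have h2 := Finset.card_filter_add_card_filter_not (s := (Finset.univ : Finset (VertexPair N)))
      (fun e : VertexPair N => edgeVector G e = true)
    have h3 : Fintype.card (VertexPair N) = (Fintype.card (Fin N)).choose 2 :=
      Sym2.card_subtype_not_diag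
    rw [Finset.card_univ, h3, ← hcard] at h2
    rw [Nat.card_eq_fintype_card]
    omega
  rw [sparseGraph, SimpleGraph.binomialRandom_singleton, hp, hcompl, hcard]
  unfold prodBern bern
  rw [Finset.prod_ite, Finset.prod_const, Finset.prod_const,
    ENNReal.ofReal_mul (pow_nonneg h0 _), ENNReal.ofReal_pow h0, ENNReal.ofReal_pow (by linarith)]
  congr 2
  · rw [ENNReal.ofReal, Real.toNNReal_of_nonneg h0]; rfl
  · rw [ENNReal.ofReal, Real.toNNReal_of_nonneg (by linarith : 0 ≤ 1 - d / N)]; rfl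

theorem sum_sparseGraph_singleton {d : ℝ} (h0 : 0 ≤ d / N) (h1 : d / N ≤ 1)
    [Fintype (SimpleGraph (Fin N))] (F : (VertexPair N → Bool) → ENNReal) :
    ∑ G, F (edgeVector G) * sparseGraph N d {G}
      = ∑ y, ENNReal.ofReal (prodBern (d / N) y) * F y :=
  Fintype.sum_bijective edgeVector edgeVector_bijective _ _ fun G => by
    rw [sparseGraph_singleton h0 h1, mul_comm]

instance (d : ℝ) : IsProbabilityMeasure (sparseGraph N d) := by
  unfold sparseGraph; infer_instance

end Law

/-! ### Rounding -/

section Rounding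

variable {N : ℕ}

/-- The vertex set obtained by rounding. -/
def rounded (U : Fin N → ℝ) (x : EuclideanSpace ℝ (Fin N)) : Finset (Fin N) :=
  Finset.univ.filter fun i => U i ≤ x i

theorem vertexSet_roundVector (U : Fin N → ℝ) (x : EuclideanSpace ℝ (Fin N)) :
    vertexSet (roundVector U x) = rounded U x := by
  ext i
  simp only [vertexSet, roundVector, round, rounded, Set.mem_ofPred_eq, Finset.coe_filter,
    Finset.mem_univ, true_and]
  split_ifs with h
  · simp [h]
  · simp only [h, iff_false]; norm_num

theorem success_edgeVector {a : ℝ} {G : SimpleGraph (Fin N)}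
    {S : (VertexPair N → Bool) → Finset (Fin N)}
    (hG : G.IsIndepSet (S (edgeVector G) : Set (Fin N))) (ha : a ≤ (S (edgeVector G)).card) :
    Success a S (edgeVector G) := by
  refine ⟨?_, ha⟩
  rintro ⟨e, he⟩ hS
  induction e with
  | _ x y =>
    rw [mem_inside] at hS
    simp only [edgeVector, SimpleGraph.mem_edgeSet, decide_eq_false_iff_not]
    exact hG (hS x (Sym2.mem_mk_left _ _)) (hS y (Sym2.mem_mk_right _ _)) he

theorem volume_Icc_neg_one_one : (volume : Measure ℝ) (Set.Icc (-1) 1) = 2 := by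
  rw [Real.volume_Icc]; norm_num

instance : IsProbabilityMeasure (ProbabilityTheory.cond volume (Set.Icc (-1 : ℝ) 1)) :=
  ProbabilityTheory.cond_isProbabilityMeasure_of_finite (by simp) (by simp)

instance : IsProbabilityMeasure (uniformNoise N) := by unfold uniformNoise; infer_instance

/-- The two roundings differ only for thresholds between `x` and `x'`, and the density is at most
1/2. -/
theorem uniform_threshold_le (x x' : ℝ) :
    ProbabilityTheory.cond volume (Set.Icc (-1 : ℝ) 1) {u | ¬ (u ≤ x ↔ u ≤ x')}
      ≤ ENNReal.ofReal (|x - x'| / 2) := by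
  have h1 : {u | ¬ (u ≤ x ↔ u ≤ x')} ⊆ Set.uIcc x x' := by
    intro u hu
    rw [Set.mem_ofPred_eq] at hu
    rw [Set.mem_uIcc]
    by_cases h : u ≤ x <;> by_cases h' : u ≤ x' <;> simp only [h, h', not_true_eq_false] at hu
    · right; exact ⟨(not_le.1 h').le, h⟩
    · left; exact ⟨(not_le.1 h).le, h'⟩
  rw [ProbabilityTheory.cond_apply measurableSet_Icc, volume_Icc_neg_one_one]
  have h2 : volume (Set.Icc (-1 : ℝ) 1 ∩ {u | ¬ (u ≤ x ↔ u ≤ x')}) ≤ ENNReal.ofReal |x - x'| := by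
    refine (measure_mono (Set.inter_subset_right.trans h1)).trans ?_
    rw [Real.volume_interval, abs_sub_comm]
  refine (mul_le_mul_right h2 _).trans ?_
  rw [ENNReal.ofReal_div_of_pos two_pos, ENNReal.div_eq_inv_mul]
  simp

theorem measurableSet_threshold (x x' : ℝ) : MeasurableSet {u : ℝ | ¬ (u ≤ x ↔ u ≤ x')} := by
  have h : {u : ℝ | ¬ (u ≤ x ↔ u ≤ x')} = symmDiff (Set.Iic x) (Set.Iic x') := by
    ext u
    simp only [Set.mem_ofPred_eq, Set.mem_symmDiff, Set.mem_Iic]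
    tauto
  rw [h]
  exact measurableSet_Iic.symmDiff measurableSet_Iic

theorem measurableSet_eval_threshold (x x' : EuclideanSpace ℝ (Fin N)) (i : Fin N) :
    MeasurableSet (Function.eval i ⁻¹' {u : ℝ | ¬ (u ≤ x i ↔ u ≤ x' i)} : Set (Fin N → ℝ)) :=
  measurable_pi_apply i (measurableSet_threshold _ _)

theorem ofReal_card_symmDiff_rounded (x x' : EuclideanSpace ℝ (Fin N)) (U : Fin N → ℝ) :
    ENNReal.ofReal ((symmDiff (rounded U x) (rounded U x')).card : ℝ)
      = ∑ i, (Function.eval i ⁻¹' {u : ℝ | ¬ (u ≤ x i ↔ u ≤ x' i)}).indicator 1 U := by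
  have h2 : symmDiff (rounded U x) (rounded U x')
      = Finset.univ.filter fun i => ¬ (U i ≤ x i ↔ U i ≤ x' i) := by
    ext i
    simp only [rounded, Finset.mem_symmDiff, Finset.mem_filter, Finset.mem_univ, true_and]
    tauto
  rw [h2, ENNReal.ofReal_natCast, Finset.card_filter, Nat.cast_sum]
  refine Finset.sum_congr rfl fun i _ => ?_
  by_cases h : (U i ≤ x i ↔ U i ≤ x' i) <;> simp [Set.indicator, h]

theorem measurable_card_symmDiff_rounded (x x' : EuclideanSpace ℝ (Fin N)) :
    Measurable fun U : Fin N → ℝ =>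
      ENNReal.ofReal ((symmDiff (rounded U x) (rounded U x')).card : ℝ) := by
  simp only [ofReal_card_symmDiff_rounded]
  exact Finset.measurable_sum _ fun i _ =>
    measurable_one.indicator (measurableSet_eval_threshold x x' i)

theorem lintegral_card_symmDiff_rounded_le (x x' : EuclideanSpace ℝ (Fin N)) :
    ∫⁻ U, ENNReal.ofReal ((symmDiff (rounded U x) (rounded U x')).card : ℝ) ∂uniformNoise N
      ≤ ENNReal.ofReal (∑ i, |x i - x' i| / 2) := by
  simp only [ofReal_card_symmDiff_rounded]
  rw [lintegral_finsetSum _ fun i _ => measurable_one.indicator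
      (measurableSet_eval_threshold x x' i),
    ENNReal.ofReal_sum_of_nonneg fun i _ => by positivity]
  refine Finset.sum_le_sum fun i _ => ?_
  rw [lintegral_indicator_one (measurableSet_eval_threshold x x' i)]
  refine le_trans (le_of_eq ?_) (uniform_threshold_le (x i) (x' i))
  exact (measurePreserving_eval (fun _ : Fin N =>
    ProbabilityTheory.cond volume (Set.Icc (-1 : ℝ) 1)) i).measure_preimage
      (measurableSet_threshold _ _).nullMeasurableSet

end Rounding

/-! ### Removing the external randomness -/

section Derandomize

variable {N : ℕ} {Ω : Type*} [MeasurableSpace Ω]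
  {A : (VertexPair N → Bool) → Ω → EuclideanSpace ℝ (Fin N)}

theorem measurable_rounded (hA : Measurable (Function.uncurry A)) (y : VertexPair N → Bool)
    (Q : Finset (Fin N) → Prop) :
    MeasurableSet {z : Ω × (Fin N → ℝ) | Q (rounded z.2 (A y z.1))} := by
  have hAy : ∀ i, Measurable fun z : Ω × (Fin N → ℝ) => A y z.1 i := fun i => by
    have h1 : Measurable fun z : Ω × (Fin N → ℝ) => A y z.1 :=
      hA.comp (measurable_const.prodMk measurable_fst)
    exact ((EuclideanSpace.proj i : EuclideanSpace ℝ (Fin N) →L[ℝ] ℝ).measurable).comp h1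
  have hB : ∀ i, MeasurableSet {z : Ω × (Fin N → ℝ) | z.2 i ≤ A y z.1 i} := fun i =>
    measurableSet_le ((measurable_pi_apply i).comp measurable_snd) (hAy i)
  have h2 : {z : Ω × (Fin N → ℝ) | Q (rounded z.2 (A y z.1))}
      = ⋃ s ∈ {s | Q s}, ⋂ i, {z : Ω × (Fin N → ℝ) | i ∈ s ↔ z.2 i ≤ A y z.1 i} := by
    ext z
    simp only [Set.mem_ofPred_eq, Set.mem_iUnion, Set.mem_iInter, exists_prop]
    constructor
    · intro h; exact ⟨_, h, fun i => by simp [rounded]⟩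
    · rintro ⟨s, hs, h⟩
      convert hs
      ext i; simp [rounded, h]
  rw [h2]
  refine MeasurableSet.biUnion (Set.to_countable _) fun s _ => MeasurableSet.iInter fun i => ?_
  by_cases hi : i ∈ s
  · simpa [hi] using hB i
  · have h3 := (hB i).compl
    simp only [hi, false_iff]
    exact h3

variable (P : Measure Ω) [IsProbabilityMeasure P]

open Classical in
-- The event is covered by finitely many slices, one per graph, so only the slices need to be
-- measurable.
theorem measure_success_le (hA : Measurable (Function.uncurry A)) {d : ℝ} (h0 : 0 ≤ d / N)
    (h1 : d / N ≤ 1) (a : ℝ) :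
    ((sparseGraph N d).prod (P.prod (uniformNoise N)))
      {z : SimpleGraph (Fin N) × (Ω × (Fin N → ℝ)) |
        z.1.IsIndepSet (vertexSet (roundVector z.2.2 (A (edgeVector z.1) z.2.1))) ∧
        a ≤ ((vertexSet (roundVector z.2.2 (A (edgeVector z.1) z.2.1))).ncard : ℝ)}
      ≤ ∫⁻ z, ENNReal.ofReal (∑ y, prodBern (d / N) y *
          if Success a (fun y => rounded z.2 (A y z.1)) y then 1 else 0)
          ∂(P.prod (uniformNoise N)) := by
  let E : (VertexPair N → Bool) → Set (Ω × (Fin N → ℝ)) := fun y =>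
    {z | Success a (fun y => rounded z.2 (A y z.1)) y}
  have hE : ∀ y, MeasurableSet (E y) := fun y =>
    measurable_rounded hA y fun s => (∀ e ∈ inside s, y e = false) ∧ a ≤ s.card
  have hsub : {z : SimpleGraph (Fin N) × (Ω × (Fin N → ℝ)) |
        z.1.IsIndepSet (vertexSet (roundVector z.2.2 (A (edgeVector z.1) z.2.1))) ∧
        a ≤ ((vertexSet (roundVector z.2.2 (A (edgeVector z.1) z.2.1))).ncard : ℝ)}
      ⊆ ⋃ G : SimpleGraph (Fin N), {G} ×ˢ E (edgeVector G) := by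
    rintro ⟨G, z⟩ ⟨hz1, hz2⟩
    rw [vertexSet_roundVector] at hz1 hz2
    rw [Set.ncard_coe_finset] at hz2
    exact Set.mem_iUnion.2 ⟨G, rfl,
      success_edgeVector (S := fun y => rounded z.2 (A y z.1)) hz1 hz2⟩
  refine (measure_mono hsub).trans ((measure_iUnion_fintype_le _ _).trans (le_of_eq ?_))
  simp only [Measure.prod_prod]
  have hsum := sum_sparseGraph_singleton h0 h1 fun y => (P.prod (uniformNoise N)) (E y)
  simp only [mul_comm (sparseGraph N d _)]
  rw [hsum]
  have hw := prodBern_nonneg (κ := VertexPair N) h0 h1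
  have hz : ∀ z : Ω × (Fin N → ℝ), ENNReal.ofReal (∑ y, prodBern (d / N) y *
          if Success a (fun y => rounded z.2 (A y z.1)) y then 1 else 0)
      = ∑ y, ENNReal.ofReal (prodBern (d / N) y) * (E y).indicator 1 z := by
    intro z
    rw [ENNReal.ofReal_sum_of_nonneg fun y _ => mul_nonneg (hw y) (by split_ifs <;> norm_num)]
    refine Finset.sum_congr rfl fun y _ => ?_
    rw [ENNReal.ofReal_mul (hw y)]
    congr 1
    simp only [Set.indicator_apply, E, Set.mem_ofPred_eq]
    split_ifs <;> simp
  simp only [hz]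
  rw [lintegral_finsetSum _ fun y _ => (measurable_one.indicator (hE y)).const_mul _]
  refine Finset.sum_congr rfl fun y _ => ?_
  rw [lintegral_const_mul _ (measurable_one.indicator (hE y)), lintegral_indicator_one (hE y)]

theorem lintegral_norm_sq_eq (hA : Measurable (Function.uncurry A)) {d : ℝ} (h0 : 0 ≤ d / N)
    (h1 : d / N ≤ 1) :
    ∫⁻ z : SimpleGraph (Fin N) × Ω, ‖A (edgeVector z.1) z.2‖ₑ ^ 2 ∂((sparseGraph N d).prod P)
      = ∫⁻ ω, ENNReal.ofReal (∑ y, prodBern (d / N) y * ‖A y ω‖ ^ 2) ∂P := by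
  classical
  have hed : Measurable (edgeVector (N := N)) := measurable_to_countable' fun y => by
    have : (edgeVector (N := N)) ⁻¹' {y} = {(Function.surjInv edgeVector_bijective.2 y)} := by
      ext G
      have h2 : edgeVector (Function.surjInv edgeVector_bijective.2 y) = y := Function.surjInv_eq _ y
      rw [Set.mem_preimage, Set.mem_singleton_iff, Set.mem_singleton_iff]
      exact ⟨fun h => edgeVector_bijective.1 (h.trans h2.symm), fun h => h ▸ h2⟩
    rw [this]; exact measurableSet_singleton _
  have hm : Measurable fun z : SimpleGraph (Fin N) × Ω => ‖A (edgeVector z.1) z.2‖ₑ ^ 2 :=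
    ((hA.comp ((hed.comp measurable_fst).prodMk measurable_snd)).enorm).pow_const 2
  rw [lintegral_prod_symm _ hm.aemeasurable]
  refine lintegral_congr fun ω => ?_
  rw [lintegral_fintype, sum_sparseGraph_singleton h0 h1 fun y => ‖A y ω‖ₑ ^ 2]
  have hw := prodBern_nonneg (κ := VertexPair N) h0 h1
  rw [ENNReal.ofReal_sum_of_nonneg fun y _ => mul_nonneg (hw y) (sq_nonneg _)]
  refine Finset.sum_congr rfl fun y _ => ?_
  rw [ENNReal.ofReal_mul (hw y), ENNReal.ofReal_pow (norm_nonneg _), ofReal_norm]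

/-- From |t|/2 ≤ λ/4 + t²/(4λ): the rounding error is a first moment, whereas low degree controls
second moments. The parameter λ is chosen at the end. -/
theorem sum_resample_abs_sub_le {p ε : ℝ} (h0 : 0 ≤ p) (h1 : p ≤ 1) (e0 : 0 ≤ ε) (e1 : ε ≤ 1)
    {D : ℕ} {f : (VertexPair N → Bool) → EuclideanSpace ℝ (Fin N)}
    (hf : ∀ i, (fun y => f y i) ∈ degreeFunctions (VertexPair N) Bool D) {lam : ℝ} (hlam : 0 < lam) :
    ∑ y, ∑ y', prodBern p y * resample p ε y y' * ∑ i, |f y i - f y' i| / 2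
      ≤ N * lam / 4 + D * ε / (2 * lam) * ∑ y, prodBern p y * ‖f y‖ ^ 2 := by
  have hw : ∀ y y' : VertexPair N → Bool, 0 ≤ prodBern p y * resample p ε y y' := fun y y' =>
    mul_nonneg (prodBern_nonneg h0 h1 y) (resample_nonneg h0 h1 e0 e1 y y')
  have habs : ∀ t : ℝ, |t| / 2 ≤ lam / 4 + t ^ 2 / (4 * lam) := by
    intro t
    have h2 : lam / 4 + t ^ 2 / (4 * lam) - |t| / 2 = (lam - |t|) ^ 2 / (4 * lam) := by
      rw [← sq_abs t]; field_simp; ring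
    have : 0 ≤ (lam - |t|) ^ 2 / (4 * lam) := by positivity
    linarith
  have hstep : ∀ y y' : VertexPair N → Bool,
      prodBern p y * resample p ε y y' * ∑ i, |f y i - f y' i| / 2
      ≤ prodBern p y * resample p ε y y' * (N * lam / 4)
        + 1 / (4 * lam) * ∑ i, prodBern p y * resample p ε y y' * (f y i - f y' i) ^ 2 := by
    intro y y'
    rw [← Finset.mul_sum, mul_left_comm, ← mul_add]
    refine mul_le_mul_of_nonneg_left ?_ (hw y y')
    refine (Finset.sum_le_sum fun i _ => habs _).trans (le_of_eq ?_)
    rw [Finset.sum_add_distrib, Finset.mul_sum]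
    simp only [Finset.sum_const, Finset.card_univ, Fintype.card_fin, nsmul_eq_mul]
    congr 1
    · ring
    · exact Finset.sum_congr rfl fun i _ => by ring
  refine (Finset.sum_le_sum fun y _ => Finset.sum_le_sum fun y' _ => hstep y y').trans ?_
  simp only [Finset.sum_add_distrib]
  rw [sum_prodBern_mul_resample_left p ε fun _ => N * lam / 4, ← Finset.sum_mul, sum_prodBern,
    one_mul]
  refine add_le_add le_rfl ?_
  simp only [← Finset.mul_sum]
  have hcomm : ∑ y, ∑ y', ∑ i, prodBern p y * resample p ε y y' * (f y i - f y' i) ^ 2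
      = ∑ i, ∑ y, ∑ y', prodBern p y * resample p ε y y' * (f y i - f y' i) ^ 2 := by
    rw [Finset.sum_comm]
    simp_rw [Finset.sum_comm (s := (Finset.univ : Finset (Fin N)))]
    rw [Finset.sum_comm]
  simp only [← Finset.mul_sum] at hcomm
  rw [hcomm]
  have hnorm : ∑ y, prodBern p y * ‖f y‖ ^ 2 = ∑ i, ∑ y, prodBern p y * f y i ^ 2 := by
    rw [Finset.sum_comm]
    refine Finset.sum_congr rfl fun y _ => ?_
    rw [EuclideanSpace.norm_sq_eq, Finset.mul_sum]
    simp
  rw [hnorm]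
  have hD := Finset.sum_le_sum fun i (_ : i ∈ (Finset.univ : Finset (Fin N))) =>
    sum_resample_sub_sq_le h0 h1 e0 e1 (hf i)
  simp only [mul_assoc, Finset.mul_sum] at hD ⊢
  calc _ ≤ _ := by
        have h4 : (0 : ℝ) ≤ 1 / (4 * lam) := by positivity
        simpa only [Finset.mul_sum] using mul_le_mul_of_nonneg_left hD h4
    _ = _ := by
        refine Finset.sum_congr rfl fun i _ => Finset.sum_congr rfl fun y _ => ?_
        field_simp
        ring

theorem lintegral_symmDiff_le (hA : Measurable (Function.uncurry A)) {d : ℝ} (h0 : 0 ≤ d / N)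
    (h1 : d / N ≤ 1) {ε : ℝ} (e0 : 0 ≤ ε) (e1 : ε ≤ 1) {D : ℕ}
    (hf : ∀ ω i, (fun y => A y ω i) ∈ degreeFunctions (VertexPair N) Bool D) {C : ℝ} (hC : 0 ≤ C)
    (hnorm : ∫⁻ z : SimpleGraph (Fin N) × Ω, ‖A (edgeVector z.1) z.2‖ₑ ^ 2
      ∂((sparseGraph N d).prod P) ≤ ENNReal.ofReal (C * N)) {lam : ℝ} (hlam : 0 < lam) :
    ∫⁻ z, ENNReal.ofReal (∑ y, ∑ y', prodBern (d / N) y * resample (d / N) ε y y' *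
        ((symmDiff (rounded z.2 (A y z.1)) (rounded z.2 (A y' z.1))).card : ℝ))
        ∂(P.prod (uniformNoise N))
      ≤ ENNReal.ofReal (N * (lam / 4 + D * ε / (2 * lam) * C)) := by
  have hw : ∀ y y' : VertexPair N → Bool, 0 ≤ prodBern (d / N) y * resample (d / N) ε y y' :=
    fun y y' => mul_nonneg (prodBern_nonneg h0 h1 y) (resample_nonneg h0 h1 e0 e1 y y')
  -- The inequality half of Tonelli suffices and needs no joint measurability.
  refine (lintegral_prod_le _).trans ?_
  have hstep : ∀ ω, ∫⁻ U, ENNReal.ofReal (∑ y, ∑ y', prodBern (d / N) y *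
        resample (d / N) ε y y' *
        ((symmDiff (rounded U (A y ω)) (rounded U (A y' ω))).card : ℝ)) ∂(uniformNoise N)
      ≤ ENNReal.ofReal (N * lam / 4) + ENNReal.ofReal (D * ε / (2 * lam)) *
        ENNReal.ofReal (∑ y, prodBern (d / N) y * ‖A y ω‖ ^ 2) := by
    intro ω
    have hmeas := fun y y' : VertexPair N → Bool =>
      measurable_card_symmDiff_rounded (A y ω) (A y' ω)
    have hexp : ∀ U : Fin N → ℝ, ENNReal.ofReal (∑ y, ∑ y', prodBern (d / N) y *
        resample (d / N) ε y y' *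
        ((symmDiff (rounded U (A y ω)) (rounded U (A y' ω))).card : ℝ))
        = ∑ y, ∑ y', ENNReal.ofReal (prodBern (d / N) y * resample (d / N) ε y y') *
          ENNReal.ofReal ((symmDiff (rounded U (A y ω)) (rounded U (A y' ω))).card : ℝ) := by
      intro U
      rw [ENNReal.ofReal_sum_of_nonneg fun y _ => Finset.sum_nonneg fun y' _ =>
        mul_nonneg (hw y y') (Nat.cast_nonneg _)]
      refine Finset.sum_congr rfl fun y _ => ?_
      rw [ENNReal.ofReal_sum_of_nonneg fun y' _ => mul_nonneg (hw y y') (Nat.cast_nonneg _)]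
      exact Finset.sum_congr rfl fun y' _ => ENNReal.ofReal_mul (hw y y')
    simp only [hexp]
    rw [lintegral_finsetSum _ fun y _ => Finset.measurable_sum _ fun y' _ =>
      (hmeas y y').const_mul _]
    have h3 : ∀ y, ∫⁻ U, ∑ y', ENNReal.ofReal (prodBern (d / N) y * resample (d / N) ε y y') *
          ENNReal.ofReal ((symmDiff (rounded U (A y ω)) (rounded U (A y' ω))).card : ℝ)
          ∂(uniformNoise N) ≤ ENNReal.ofReal (∑ y', prodBern (d / N) y * resample (d / N) ε y y' *
            ∑ i, |A y ω i - A y' ω i| / 2) := by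
      intro y
      rw [lintegral_finsetSum _ fun y' _ => (hmeas y y').const_mul _,
        ENNReal.ofReal_sum_of_nonneg fun y' _ =>
          mul_nonneg (hw y y') (Finset.sum_nonneg fun i _ => by positivity)]
      refine Finset.sum_le_sum fun y' _ => ?_
      rw [lintegral_const_mul _ (hmeas y y'), ENNReal.ofReal_mul (hw y y')]
      exact mul_le_mul_right (lintegral_card_symmDiff_rounded_le _ _) _
    refine (Finset.sum_le_sum fun y _ => h3 y).trans ?_
    rw [← ENNReal.ofReal_sum_of_nonneg fun y _ => Finset.sum_nonneg fun y' _ =>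
        mul_nonneg (hw y y') (Finset.sum_nonneg fun i _ => by positivity)]
    rw [← ENNReal.ofReal_mul (by positivity), ← ENNReal.ofReal_add (by positivity) (mul_nonneg
      (by positivity) (Finset.sum_nonneg fun y _ =>
        mul_nonneg (prodBern_nonneg h0 h1 y) (sq_nonneg _)))]
    exact ENNReal.ofReal_le_ofReal (sum_resample_abs_sub_le h0 h1 e0 e1 (hf ω) hlam)
  refine (lintegral_mono hstep).trans ?_
  rw [lintegral_add_left measurable_const, lintegral_const, measure_univ, mul_one,
    lintegral_const_mul' _ _ ENNReal.ofReal_ne_top, ← lintegral_norm_sq_eq P hA h0 h1]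
  refine (add_le_add le_rfl (mul_le_mul_right hnorm _)).trans ?_
  rw [← ENNReal.ofReal_mul (by positivity), ← ENNReal.ofReal_add (by positivity) (by positivity)]
  refine ENNReal.ofReal_le_ofReal (le_of_eq ?_)
  ring

end Derandomize

end SparseIndep

end

/-! ### Averaging over the external randomness -/

theorem corollary3p10 (ι : ℝ) (hι : 0 < ι) :
    ∃ dStar : ℝ, ∀ d : ℝ, dStar ≤ d →
      ∀ (C : ℝ) (D : ℕ → ℕ),
        (fun N : ℕ => (D N : ℝ)) =o[atTop] (fun N : ℕ => (N : ℝ)) →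
      ∀ (Ω : ℕ → Type*) [∀ N, MeasurableSpace (Ω N)]
        (P : ∀ N, Measure (Ω N)) [∀ N, IsProbabilityMeasure (P N)]
        (A : ∀ N, (SparseIndep.VertexPair N → Bool) → Ω N → EuclideanSpace ℝ (Fin N)),
        (∀ N, Measurable (Function.uncurry (A N))) →
        (∀ N (ω : Ω N) (i : Fin N), (fun y => A N y ω i) ∈
          SparseIndep.degreeFunctions (SparseIndep.VertexPair N) Bool (D N)) →
        (∀ᶠ N : ℕ in atTop,
          ∫⁻ z : SimpleGraph (Fin N) × Ω N, ‖A N (SparseIndep.edgeVector z.1) z.2‖ₑ ^ 2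
            ∂((SparseIndep.sparseGraph N d).prod (P N)) ≤ ENNReal.ofReal (C * N)) →
        Tendsto
          (fun N : ℕ =>
            ((SparseIndep.sparseGraph N d).prod ((P N).prod (SparseIndep.uniformNoise N)))
              {z : SimpleGraph (Fin N) × (Ω N × (Fin N → ℝ)) |
                z.1.IsIndepSet (SparseIndep.vertexSet (SparseIndep.roundVector z.2.2
                  (A N (SparseIndep.edgeVector z.1) z.2.1))) ∧
                (1 + ι) * Real.log d / d * N ≤
                  ((SparseIndep.vertexSet (SparseIndep.roundVector z.2.2
                    (A N (SparseIndep.edgeVector z.1) z.2.1))).ncard : ℝ)})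
          atTop (𝓝 0) := by
  classical
  obtain ⟨dStar, hd1, hmain⟩ := SparseIndep.eventually_not_stable hι
  refine ⟨dStar, fun d hd C D hD Ω _ P _ A hA hdeg hnorm => ?_⟩
  have hd0 : 0 < d := by linarith
  have hℓ0 : 0 < Real.log d := Real.log_pos (by linarith)
  refine ENNReal.tendsto_nhds_zero.2 fun δ hδ => ?_
  obtain ⟨π', hπ', hπδ⟩ : ∃ π' : ℝ, (0 < π' ∧ π' ≤ 1) ∧ ENNReal.ofReal π' ≤ δ := by
    rcases eq_or_ne δ ⊤ with rfl | hδt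
    · exact ⟨1, ⟨one_pos, le_rfl⟩, le_top⟩
    · refine ⟨min δ.toReal 1, ⟨lt_min (ENNReal.toReal_pos hδ.ne' hδt) one_pos, min_le_right _ _⟩, ?_⟩
      exact (ENNReal.ofReal_le_ofReal (min_le_left _ _)).trans (ENNReal.ofReal_toReal hδt).le
  obtain ⟨hπ0, hπ1⟩ := hπ'
  -- Instability per vertex forced by a success probability of at least π'/2. The choices of `lam`
  -- and `c₀` below make each of the two terms of the mean instability per vertex at most h₀π'/8.
  set h₀ : ℝ := (π' / 2) ^ 2 / 2 * (ι / 4 * (Real.log d / d)) with hh₀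
  have hh₀pos : 0 < h₀ := by positivity
  set lam : ℝ := h₀ * π' / 2 with hlam
  have hlampos : 0 < lam := by positivity
  -- The constant `C` may be nonpositive, and `c₀` divides by its replacement.
  set C' : ℝ := max C 1
  have hC' : 0 < C' := lt_max_of_lt_right one_pos
  set c₀ : ℝ := min 1 (h₀ * π' * lam / (4 * C'))
  have hc₀pos : 0 < c₀ := lt_min one_pos (by positivity)
  have hev := hmain d hd D hD (π' / 2) (by positivity) (by linarith) c₀ hc₀pos (min_le_left _ _)
  filter_upwards [hev, hnorm, tendsto_natCast_atTop_atTop.eventually_ge_atTop d] with N hev hnorm hdN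
  have hN : (0 : ℝ) < N := hd0.trans_le hdN
  have h0 : 0 ≤ d / N := by positivity
  have h1 : d / N ≤ 1 := (div_le_one hN).2 hdN
  set ε : ℝ := c₀ / (D N + 1) with hε
  have hD1 : (1 : ℝ) ≤ D N + 1 := by linarith [Nat.cast_nonneg (α := ℝ) (D N)]
  have e0 : 0 ≤ ε := by positivity
  have e1 : ε ≤ 1 := (div_le_one (by positivity)).2 ((min_le_left _ _).trans hD1)
  have hDε : D N * ε ≤ c₀ := by
    rw [hε, mul_div_assoc', div_le_iff₀ (by positivity)]
    nlinarith
  have hnorm' : ∫⁻ z : SimpleGraph (Fin N) × Ω N, ‖A N (SparseIndep.edgeVector z.1) z.2‖ₑ ^ 2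
      ∂((SparseIndep.sparseGraph N d).prod (P N)) ≤ ENNReal.ofReal (C' * N) :=
    hnorm.trans (ENNReal.ofReal_le_ofReal (mul_le_mul_of_nonneg_right (le_max_left _ _) hN.le))
  have hstab := SparseIndep.lintegral_symmDiff_le (P N) (hA N) h0 h1 e0 e1 (hdeg N) hC'.le hnorm'
    hlampos
  have hsucc := SparseIndep.measure_success_le (P N) (hA N) h0 h1 ((1 + ι) * Real.log d / d * N)
  refine hsucc.trans (le_trans ?_ hπδ)
  set H : Ω N × (Fin N → ℝ) → ℝ := fun z => ∑ y, ∑ y', SparseIndep.prodBern (d / N) y *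
    SparseIndep.resample (d / N) ε y y' * ((symmDiff (SparseIndep.rounded z.2 (A N y z.1))
      (SparseIndep.rounded z.2 (A N y' z.1))).card : ℝ)
  have hw := SparseIndep.prodBern_nonneg (κ := SparseIndep.VertexPair N) h0 h1
  have hH0 : ∀ z, 0 ≤ H z := fun z => Finset.sum_nonneg fun y _ => Finset.sum_nonneg fun y' _ =>
    mul_nonneg (mul_nonneg (hw y) (SparseIndep.resample_nonneg h0 h1 e0 e1 y y'))
      (Nat.cast_nonneg _)
  -- For fixed ω and U, either the success probability is below π'/2, or the instability exceeds h₀N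
  -- and the last term is at least 1.
  have hpoint : ∀ z : Ω N × (Fin N → ℝ), (∑ y, SparseIndep.prodBern (d / N) y *
      if SparseIndep.Success ((1 + ι) * Real.log d / d * N)
        (fun y => SparseIndep.rounded z.2 (A N y z.1)) y then 1 else 0)
      ≤ π' / 2 + 1 / (h₀ * N) * H z := by
    intro z
    have hthr : (1 + ι) * Real.log d / d * N = (1 + ι) * (Real.log d / d * N) := by ring
    rw [hthr]
    by_cases hz : π' / 2 ≤ ∑ y, SparseIndep.prodBern (d / N) y *
      if SparseIndep.Success ((1 + ι) * (Real.log d / d * N))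
        (fun y => SparseIndep.rounded z.2 (A N y z.1)) y then 1 else 0
    · have h2 := hev (fun y => SparseIndep.rounded z.2 (A N y z.1)) hz
      have h3 : (π' / 2) ^ 2 / 2 * (ι / 4 * (Real.log d / d * N)) = h₀ * N := by rw [hh₀]; ring
      rw [h3] at h2
      have h4 : 1 ≤ 1 / (h₀ * N) * H z := by
        rw [one_div_mul_eq_div, one_le_div (by positivity)]
        exact h2.le
      have h5 : (∑ y, SparseIndep.prodBern (d / N) y *
          if SparseIndep.Success ((1 + ι) * (Real.log d / d * N))
            (fun y => SparseIndep.rounded z.2 (A N y z.1)) y then 1 else 0) ≤ 1 := by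
        refine (Finset.sum_le_sum fun y _ => mul_le_of_le_one_right (hw y) ?_).trans
          (SparseIndep.sum_prodBern (κ := SparseIndep.VertexPair N) (d / N)).le
        split_ifs <;> norm_num
      linarith
    · have : 0 ≤ 1 / (h₀ * N) * H z := mul_nonneg (by positivity) (hH0 z)
      linarith
  refine (lintegral_mono fun z => ENNReal.ofReal_le_ofReal (hpoint z)).trans ?_
  have hsplit : ∀ z, ENNReal.ofReal (π' / 2 + 1 / (h₀ * N) * H z)
      = ENNReal.ofReal (π' / 2) + ENNReal.ofReal (1 / (h₀ * N)) * ENNReal.ofReal (H z) := fun z => by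
    rw [ENNReal.ofReal_add (by positivity) (mul_nonneg (by positivity) (hH0 z)),
      ENNReal.ofReal_mul (by positivity)]
  simp only [hsplit]
  rw [lintegral_add_left measurable_const, lintegral_const, measure_univ, mul_one,
    lintegral_const_mul' _ _ ENNReal.ofReal_ne_top]
  refine (add_le_add le_rfl (mul_le_mul_right hstab _)).trans ?_
  rw [← ENNReal.ofReal_mul (by positivity), ← ENNReal.ofReal_add (by positivity) (by positivity)]
  refine ENNReal.ofReal_le_ofReal ?_
  have h6 : D N * ε / (2 * lam) * C' ≤ h₀ * π' / 8 := by
    have h7 : c₀ ≤ h₀ * π' * lam / (4 * C') := min_le_right _ _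
    rw [div_mul_eq_mul_div, div_le_iff₀ (by positivity)]
    have h8 := mul_le_mul_of_nonneg_right (hDε.trans h7) hC'.le
    refine h8.trans (le_of_eq ?_)
    field_simp
    ring
  have h9 : 1 / (h₀ * N) * (N * (lam / 4 + D N * ε / (2 * lam) * C'))
      = (lam / 4 + D N * ε / (2 * lam) * C') / h₀ := by field_simp
  rw [h9]
  have h10 : (lam / 4 + D N * ε / (2 * lam) * C') / h₀ ≤ π' / 2 := by
    rw [div_le_iff₀ hh₀pos]
    have : 0 < h₀ * π' := by positivity
    rw [hlam] at h6 ⊢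
    linarith
  linarith
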